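/- Proposition (Uniform bounds for the free Schrödinger flow). Work on $L^2(\mathbb{R}^3)=L^2(\mathbb{R}^3;\mathbb{C})$. For $\hbar>0$ and $t\in\mathbb{R}$ let $\mathcal{U}^\hbar(t)=e^{\frac{it\hbar}{2}\Delta}$, let $\langle x\rangle=(1+|x|^2)^{1/2}$, let $\langle x\rangle^\sigma$ be the corresponding multiplication operator and $\langle\hbar\nabla\rangle^\sigma=(1-\hbar^2\Delta)^{\sigma/2}$, both with their maximal domains. For a bounded operator $A$ put $\|A\|_{\mathfrak{L}^r_\hbar}=(2\pi\hbar)^{3/r}\|A\|_{\mathfrak{S}^r}$, where $\|A\|_{\mathfrak{S}^r}=(\mathrm{Tr}\,|A|^r)^{1/r}$ is the Schatten norm for $1\le r<\infty$ and the operator norm for $r=\infty$. If $W$ is one of the two weights above, we write $\|W\gamma_0W\|_{\mathfrak{L}^r_\hbar}$ for the norm of the bounded operator $B$ with $\gamma_0Wf\in\mathrm{Dom}(W)$ and $W\gamma_0Wf=Bf$ for all $f\in\mathrm{Dom}(W)$, and $\|W\gamma_0W\|_{\mathfrak{L}^r_\hbar}=\infty$ if there is no such $B$. The rescaled density $\rho^\hbar_A$,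 formally $\rho^\hbar_A(x)=(2\pi\hbar)^3A(x,x)$ with $A(x,x')$ the integral kernel of $A$, is the locally integrable function with $\int_S\rho^\hbar_A\,dx=(2\pi\hbar)^3\,\mathrm{Tr}(\mathbf 1_SA\mathbf 1_S)$ for every bounded measurable $S\subset\mathbb{R}^3$; it is said to exist if there is such a function and all the operators $\mathbf 1_SA\mathbf 1_S$ are of trace class. Let $1\le r\le\infty$, let $r'$ be the conjugate exponent, $\frac1r+\frac1{r'}=1$, and let $\sigma>\frac{3}{2r'}$. Then there is a constant $C_{\sigma,r}>0$ such that, for all $\hbar>0$, all $t\in\mathbb{R}$ and all bounded operators $\gamma_0$ on $L^2(\mathbb{R}^3)$, $$\big\|\rho^\hbar_{\mathcal{U}^\hbar(t)\gamma_0\mathcal{U}^\hbar(t)^*}\big\|_{L^r(\mathbb{R}^3)}\le C_{\sigma,r}\,\|\langle\hbar\nabla\rangle^\sigma\gamma_0\langle\hbar\nabla\rangle^\sigma\|_{\mathfrak{L}^r_\hbar},$$ and, if $t\ne0$ or $r=1$, $$\big\|\rho^\hbar_{\mathcal{U}^\hbar(t)\gamma_0\mathcal{U}^\hbar(t)^*}\big\|_{L^r(\mathbb{R}^3)}\le\frac{C_{\sigma,r}}{|t|^{3/r'}}\,\|\langle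 x\rangle^\sigma\gamma_0\langle x\rangle^\sigma\|_{\mathfrak{L}^r_\hbar}$$ (with $|t|^{3/r'}=1$ for $r=1$). In each case finiteness of the norm on the right-hand side implies that the density exists. -/

import Mathlib

open MeasureTheory
open scoped ENNReal FourierTransform InnerProductSpace

noncomputable section

namespace Semiclassical

section Schatten

variable {H : Type*} [NormedAddCommGroup H] [InnerProductSpace ℂ H] [CompleteSpace H]

/-- The index set of a chosen orthonormal (Hilbert) basis of `H`. -/
def basisIndex (H : Type*) [NormedAddCommGroup H] [InnerProductSpace ℂ H] [CompleteSpace H] :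
    Set H :=
  (exists_hilbertBasis ℂ H).choose

/-- A chosen orthonormal (Hilbert) basis of `H`. The traces below do not depend on the choice. -/
def chosenBasis (H : Type*) [NormedAddCommGroup H] [InnerProductSpace ℂ H] [CompleteSpace H] :
    HilbertBasis (basisIndex H) ℂ H :=
  (exists_hilbertBasis ℂ H).choose_spec.choose

/-- The trace `∑ᵢ ⟨eᵢ, T eᵢ⟩ ∈ [0, ∞]` of a non-negative operator `T`. -/
def posTrace (T : H →L[ℂ] H) : ℝ≥0∞ :=
  ∑' i, ENNReal.ofReal (⟪chosenBasis H i, T (chosenBasis H i)⟫_ℂ).re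

/-- The Schatten norm `‖A‖_{𝔖^r} = (Tr |A|^r)^{1/r}`, `|A| = √(A* A)`, with value `∞` outside the
Schatten class; for `r = ∞` it is the operator norm. -/
def schattenNorm (r : ℝ≥0∞) (A : H →L[ℂ] H) : ℝ≥0∞ :=
  if r = ∞ then ‖A‖ₑ else (posTrace (CFC.abs A ^ r.toReal)) ^ (1 / r.toReal)

/-- Trace class operators: `Tr |A| < ∞`. -/
def IsTraceClass (A : H →L[ℂ] H) : Prop := schattenNorm 1 A < ∞

/-- The trace `∑ᵢ ⟨eᵢ, A eᵢ⟩`; the sum converges absolutely for trace class `A`, and the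
definition is only used for such `A`. -/
def trace (A : H →L[ℂ] H) : ℂ := ∑' i, ⟪chosenBasis H i, A (chosenBasis H i)⟫_ℂ

/-- `B` is the bounded operator `W A W`, where `W` is an unbounded operator: for every `f` in the
domain of `W`, the vector `A W f` lies in the domain of `W`, and `W A W f = B f`. -/
def IsSandwich (W : H →ₗ.[ℂ] H) (A B : H →L[ℂ] H) : Prop :=
  ∀ f : W.domain, ∃ h : A (W f) ∈ W.domain, W ⟨A (W f), h⟩ = B f

/-- The semiclassical Schatten norm `‖A‖_{𝔏^r_ħ} = (2πħ)^{3/r} ‖A‖_{𝔖^r}`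
(in three space dimensions). -/
def scaledSchattenNorm (ħ : ℝ) (r : ℝ≥0∞) (A : H →L[ℂ] H) : ℝ≥0∞ :=
  ENNReal.ofReal ((2 * Real.pi * ħ) ^ (3 * (r⁻¹).toReal)) * schattenNorm r A

/-- `‖W A W‖_{𝔏^r_ħ}` for an unbounded (densely defined) `W`; the value is `∞` if `W A W` is not a
bounded operator. The operator `B = W A W` is unique, so that the infimum is over one operator at
most. -/
def sandwichNorm (ħ : ℝ) (r : ℝ≥0∞) (W : H →ₗ.[ℂ] H) (A : H →L[ℂ] H) : ℝ≥0∞ :=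
  ⨅ (B : H →L[ℂ] H) (_ : IsSandwich W A B), scaledSchattenNorm ħ r B

end Schatten

/-- Three-dimensional Euclidean space. -/
abbrev E3 : Type := EuclideanSpace ℝ (Fin 3)

/-- The Hilbert space `L²(ℝ³; ℂ)`. -/
abbrev L2 : Type := Lp ℂ 2 (volume : Measure E3)

theorem mul_add_ae (m : E3 → ℂ) (f g : L2) :
    (fun x => m x * (f + g : L2) x) =ᵐ[volume] (fun x => m x * f x) + fun x => m x * g x := by
  filter_upwards [Lp.coeFn_add f g] with x hx
  simp only [hx, Pi.add_apply, mul_add]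

theorem mul_smul_ae (m : E3 → ℂ) (c : ℂ) (f : L2) :
    (fun x => m x * (c • f : L2) x) =ᵐ[volume] c • fun x => m x * f x := by
  filter_upwards [Lp.coeFn_smul c f] with x hx
  simp only [hx, Pi.smul_apply, smul_eq_mul, mul_left_comm]

/-- Multiplication by the function `m`, with its maximal domain
`{f ∈ L² : m f ∈ L²}`, as an unbounded operator on `L²`. -/
def mulOp (m : E3 → ℂ) : L2 →ₗ.[ℂ] L2 where
  domain :=
    { carrier := {f | MemLp (fun x => m x * f x) 2 volume}
      zero_mem' := by
        refine (memLp_congr_ae ?_).2 (MemLp.zero (ε := ℂ))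
        filter_upwards [Lp.coeFn_zero ℂ 2 (volume : Measure E3)] with x hx
        simp [hx]
      add_mem' := fun {f g} hf hg => (memLp_congr_ae (mul_add_ae m f g)).2 (hf.add hg)
      smul_mem' := fun c f hf => (memLp_congr_ae (mul_smul_ae m c f)).2 (hf.const_smul c) }
  toFun :=
    { toFun := fun f => MemLp.toLp _ f.2
      map_add' := fun f g => by
        rw [← MemLp.toLp_add]
        exact MemLp.toLp_congr _ _ (mul_add_ae m f g)
      map_smul' := fun c f => by
        rw [RingHom.id_apply, ← MemLp.toLp_const_smul]
        exact MemLp.toLp_congr _ _ (mul_smul_ae m c f) }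

theorem memLp_mul_bounded {m : E3 → ℂ} (hm : Measurable m) (hb : ∀ x, ‖m x‖ ≤ 1) (f : L2) :
    MemLp (fun x => m x * f x) 2 volume := by
  refine (Lp.memLp f).mono (hm.aestronglyMeasurable.mul (Lp.memLp f).1) ?_
  filter_upwards with x
  rw [norm_mul]
  exact mul_le_of_le_one_left (norm_nonneg _) (hb x)

/-- Multiplication by a measurable function `m` with `|m| ≤ 1`, as a bounded operator on `L²`. -/
def mulCLM (m : E3 → ℂ) (hm : Measurable m) (hb : ∀ x, ‖m x‖ ≤ 1) : L2 →L[ℂ] L2 :=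
  LinearMap.mkContinuous
    { toFun := fun f => MemLp.toLp _ (memLp_mul_bounded hm hb f)
      map_add' := fun f g => by
        rw [← MemLp.toLp_add]
        exact MemLp.toLp_congr _ _ (mul_add_ae m f g)
      map_smul' := fun c f => by
        rw [RingHom.id_apply, ← MemLp.toLp_const_smul]
        exact MemLp.toLp_congr _ _ (mul_smul_ae m c f) }
    1 (fun f => by
      rw [one_mul]
      refine Lp.norm_le_norm_of_ae_le ?_
      filter_upwards [MemLp.coeFn_toLp (memLp_mul_bounded hm hb f)] with x hx
      rw [LinearMap.coe_mk, AddHom.coe_mk, hx, norm_mul]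
      exact mul_le_of_le_one_left (norm_nonneg _) (hb x))

/-- The Fourier transform of `L²(ℝ³)`, `𝓕 f(ξ) = ∫ e^{-2πi x·ξ} f(x) dx`, as a unitary map. -/
abbrev fourierL2 : L2 ≃ₗᵢ[ℂ] L2 := Lp.fourierTransformₗᵢ E3 ℂ

/-- The Fourier multiplier `𝓕⁻¹ m 𝓕` with its maximal domain `{f ∈ L² : m 𝓕 f ∈ L²}`, as an
unbounded operator on `L²`. -/
def fourierMulOp (m : E3 → ℂ) : L2 →ₗ.[ℂ] L2 where
  domain := (mulOp m).domain.comap (fourierL2.toLinearEquiv : L2 →ₗ[ℂ] L2)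
  toFun :=
    (fourierL2.symm.toLinearEquiv : L2 →ₗ[ℂ] L2) ∘ₗ (mulOp m).toFun ∘ₗ
      (fourierL2.toLinearEquiv : L2 →ₗ[ℂ] L2).restrict (fun _ hf => hf)

/-- The Japanese bracket `⟨x⟩ = (1 + |x|²)^{1/2}`. -/
def bracket (x : E3) : ℝ := Real.sqrt (1 + ‖x‖ ^ 2)

/-- The operator of multiplication by `⟨x⟩^σ`. -/
def positionWeight (σ : ℝ) : L2 →ₗ.[ℂ] L2 :=
  mulOp fun x => ((bracket x ^ σ : ℝ) : ℂ)

/-- The operator `⟨ħ∇⟩^σ = (1 - ħ²Δ)^{σ/2}`. With the normalisation of the Fourier transform used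
here, `-iħ∇` is multiplication by `2πħξ` on the Fourier side. -/
def momentumWeight (ħ σ : ℝ) : L2 →ₗ.[ℂ] L2 :=
  fourierMulOp fun ξ => ((bracket ((2 * Real.pi * ħ) • ξ) ^ σ : ℝ) : ℂ)

/-- The symbol `e^{-itħ|2πξ|²/2}` of the free Schrödinger flow. -/
def freeSymbol (ħ t : ℝ) (ξ : E3) : ℂ :=
  Complex.exp (((-(t * ħ * (2 * Real.pi * ‖ξ‖) ^ 2 / 2) : ℝ) : ℂ) * Complex.I)

theorem measurable_freeSymbol (ħ t : ℝ) : Measurable (freeSymbol ħ t) := by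
  unfold freeSymbol
  fun_prop

theorem norm_freeSymbol_le (ħ t : ℝ) (ξ : E3) : ‖freeSymbol ħ t ξ‖ ≤ 1 :=
  (Complex.norm_exp_ofReal_mul_I _).le

/-- The free Schrödinger propagator `𝒰^ħ(t) = e^{itħΔ/2}` on `L²(ℝ³)`. -/
def freeFlow (ħ t : ℝ) : L2 →L[ℂ] L2 :=
  (fourierL2.symm.toContinuousLinearEquiv : L2 →L[ℂ] L2) ∘L
    mulCLM (freeSymbol ħ t) (measurable_freeSymbol ħ t) (norm_freeSymbol_le ħ t) ∘L
      (fourierL2.toContinuousLinearEquiv : L2 →L[ℂ] L2)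

/-- The evolved operator `𝒰^ħ(t) γ 𝒰^ħ(t)*`. -/
def evolve (ħ t : ℝ) (γ : L2 →L[ℂ] L2) : L2 →L[ℂ] L2 :=
  freeFlow ħ t ∘L γ ∘L ContinuousLinearMap.adjoint (freeFlow ħ t)

theorem norm_indicator_one_le (S : Set E3) (x : E3) :
    ‖S.indicator (fun _ => (1 : ℂ)) x‖ ≤ 1 := by
  by_cases hx : x ∈ S <;> simp [hx]

/-- Multiplication by the indicator function of the measurable set `S`. -/
def cutoff (S : Set E3) (hS : MeasurableSet S) : L2 →L[ℂ] L2 :=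
  mulCLM (S.indicator fun _ => 1) (measurable_const.indicator hS) (norm_indicator_one_le S)

/-- `ρ` is the semiclassically rescaled density `ρ^ħ_A(x) = (2πħ)³ A(x,x)` of the operator `A`:
`A` is locally trace class and `ρ` is the (almost everywhere unique) locally integrable function
with `∫_S ρ = (2πħ)³ Tr(1_S A 1_S)` for all bounded measurable sets `S`. -/
def IsDensity (ħ : ℝ) (A : L2 →L[ℂ] L2) (ρ : E3 → ℂ) : Prop :=
  LocallyIntegrable ρ volume ∧
  ∀ (S : Set E3) (hS : MeasurableSet S), Bornology.IsBounded S →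
    IsTraceClass (cutoff S hS ∘L A ∘L cutoff S hS) ∧
    ∫ x in S, ρ x = (((2 * Real.pi * ħ) ^ 3 : ℝ) : ℂ) * trace (cutoff S hS ∘L A ∘L cutoff S hS)

end Semiclassical

end

/-!
Let `W` be one of the two weights, `R = W⁻¹`, and let `B` be the bounded operator `W γ₀ W`. Then
`γ₀ = R B R`, so the evolved operator is `(T G) B (T G)*`, where `T = V ⟨λ x⟩^{-σ}`, `‖G‖ ≤ 1`, and
`V` has a bounded integral kernel: for the momentum weight `V = 𝓕⁻¹` and `λ = 2πħ`, for the
position weight `V = 𝒰^ħ(t)`, with kernel of modulus `(2πħ|t|)^{-3/2}`, and `λ = 1`.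

The polar decomposition `B = U |B|` splits the evolved operator as `X Y*` with
`X = T G U |B|^{1/2}` and `Y = T G |B|^{1/2}`. Its density `∑ i, (X e_i) conj (Y e_i)` is dominated
by the densities `n_X`, `n_Y` of `X X*` and `Y Y*`. If `T f x = ⟪K x, f⟫` with `‖K x‖ ≤ M`, then
`n_{T |B|^{1/2}} x = ⟪K x, |B| (K x)⟫`, and Jensen's inequality for the spectral measure of `|B|`,
`⟪v, |B| v⟫^r ≤ ‖v‖^{2(r-1)} ⟪v, |B|^r v⟫`, integrates to
`‖n‖_r ≤ M^{2/r'} ‖T‖^{2/r} ‖B‖_{𝔖^r}`; it takes the place of complex interpolation.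

For `σ ≤ 3/2` the vectors `K x` are not in `L²`, so the weight is cut into the dyadic shells of
`⟨λ x⟩`. The shell of size `2^k` contributes a multiple of `2^{k(3/r' - 2σ)}`, and these bounds are
summable exactly when `σ > 3/(2r')`.
-/

noncomputable section

namespace Semiclassical

open ContinuousLinearMap (adjoint adjoint_inner_left adjoint_inner_right)

section Hilbert

theorem mul_le_sq_add_sq (a b : ℝ≥0∞) : a * b ≤ a ^ 2 + b ^ 2 := by
  rcases le_total a b with h | h
  · calc a * b ≤ b * b := by gcongr
      _ ≤ a ^ 2 + b ^ 2 := by rw [← sq]; exact le_add_self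
  · calc a * b ≤ a * a := by gcongr
      _ ≤ a ^ 2 + b ^ 2 := by rw [← sq]; exact le_self_add

theorem ofReal_norm_sq {E : Type*} [SeminormedAddCommGroup E] (v : E) :
    ENNReal.ofReal (‖v‖ ^ 2) = ‖v‖ₑ ^ 2 := by
  rw [ENNReal.ofReal_pow (norm_nonneg _), ofReal_norm]

variable {H K L : Type*} [NormedAddCommGroup H] [InnerProductSpace ℂ H]
  [NormedAddCommGroup K] [InnerProductSpace ℂ K] [NormedAddCommGroup L] [InnerProductSpace ℂ L]

theorem enorm_inner_le_sq_add_sq (v w : H) : ‖⟪v, w⟫_ℂ‖ₑ ≤ ‖v‖ₑ ^ 2 + ‖w‖ₑ ^ 2 :=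
  calc ‖⟪v, w⟫_ℂ‖ₑ ≤ ‖v‖ₑ * ‖w‖ₑ := ENNReal.coe_le_coe.2 (nnnorm_inner_le_nnnorm v w)
    _ ≤ ‖v‖ₑ ^ 2 + ‖w‖ₑ ^ 2 := mul_le_sq_add_sq _ _

theorem tsum_enorm_inner_sq {ι : Type*} (b : HilbertBasis ι ℂ H) (v : H) :
    ∑' i, ‖⟪b i, v⟫_ℂ‖ₑ ^ 2 = ‖v‖ₑ ^ 2 := by
  have h : HasSum (fun i => ‖⟪b i, v⟫_ℂ‖ ^ 2) (‖v‖ ^ 2) := by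
    simpa [b.repr_apply_apply] using lp.hasSum_norm (by norm_num) (b.repr v)
  simp_rw [← ofReal_norm_sq]
  rw [← ENNReal.ofReal_tsum_of_nonneg (fun _ => by positivity) h.summable, h.tsum_eq]

/-- Douglas' factorisation: first extend `A x ↦ B x` to the closure of the range of `A`. -/
theorem exists_contraction_comp_eq [CompleteSpace K] [CompleteSpace L]
    {A : H →L[ℂ] K} {B : H →L[ℂ] L} (h : ∀ x, ‖B x‖ ≤ ‖A x‖) :
    ∃ U : K →L[ℂ] L, ‖U‖ ≤ 1 ∧ U ∘L A = B := by
  let S : Submodule ℂ K := (LinearMap.range A.toLinearMap).topologicalClosure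
  have : CompleteSpace S := (Submodule.isClosed_topologicalClosure _).completeSpace_coe
  let e : H →ₗ[ℂ] S := A.toLinearMap.codRestrict S fun x =>
    Submodule.le_topologicalClosure _ (LinearMap.mem_range_self _ x)
  have he : DenseRange e := fun y => by
    have hy : (y : K) ∈ closure (LinearMap.range A.toLinearMap : Set K) := y.2
    refine Metric.mem_closure_iff.2 fun ε hε => ?_
    obtain ⟨_, ⟨x, rfl⟩, hx⟩ := Metric.mem_closure_iff.1 hy ε hε
    exact ⟨e x, ⟨x, rfl⟩, hx⟩
  have hB : ∀ x, ‖B.toLinearMap x‖ ≤ 1 * ‖e x‖ := fun x => (h x).trans_eq (one_mul _).symm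
  refine ⟨B.toLinearMap.extendOfNorm e ∘L S.orthogonalProjectionOnto, ?_, ?_⟩
  · refine (ContinuousLinearMap.opNorm_comp_le _ _).trans ?_
    exact mul_le_one₀ (LinearMap.opNorm_extendOfNorm_le he zero_le_one hB) (norm_nonneg _)
      (Submodule.orthogonalProjectionOnto_norm_le S)
  · ext x
    have hproj : S.orthogonalProjectionOnto (A x) = e x :=
      Submodule.orthogonalProjectionOnto_mem_subspace_eq_self (e x)
    rw [ContinuousLinearMap.comp_apply, ContinuousLinearMap.comp_apply, hproj]
    exact LinearMap.extendOfNorm_eq he ⟨1, hB⟩ x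

theorem adjoint_comp_eq_of_norm_le_one [CompleteSpace K] [CompleteSpace L]
    {A : H →L[ℂ] K} {U : K →L[ℂ] L} (hU : ‖U‖ ≤ 1)
    (h : ∀ x, ‖U (A x)‖ = ‖A x‖) : adjoint U ∘L U ∘L A = A := by
  ext x
  have hinner : RCLike.re ⟪adjoint U (U (A x)), A x⟫_ℂ = ‖A x‖ ^ 2 := by
    rw [adjoint_inner_left, inner_self_eq_norm_sq, h]
  have hnorm : ‖adjoint U (U (A x))‖ ≤ ‖A x‖ := by
    refine ((adjoint U).le_opNorm _).trans ?_
    rw [LinearIsometryEquiv.norm_map, h]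
    exact mul_le_of_le_one_left (norm_nonneg _) hU
  have hdist := @norm_sub_sq ℂ K _ _ _ (adjoint U (U (A x))) (A x)
  rw [hinner] at hdist
  have hzero : ‖adjoint U (U (A x)) - A x‖ = 0 := by
    nlinarith [norm_nonneg (adjoint U (U (A x))), norm_nonneg (adjoint U (U (A x)) - A x),
      norm_nonneg (A x)]
  exact sub_eq_zero.1 (norm_eq_zero.1 hzero)

variable [CompleteSpace H]

/-- The square `∑ᵢ ‖X eᵢ‖²` of the Hilbert–Schmidt norm. -/
def hsNormSq (X : H →L[ℂ] K) : ℝ≥0∞ := ∑' i, ‖X (chosenBasis H i)‖ₑ ^ 2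

theorem hsNormSq_comp_le_left (X : K →L[ℂ] L) (Y : H →L[ℂ] K) :
    hsNormSq (X ∘L Y) ≤ ‖X‖ₑ ^ 2 * hsNormSq Y := by
  unfold hsNormSq
  rw [← ENNReal.tsum_mul_left]
  refine ENNReal.tsum_le_tsum fun i => ?_
  rw [← mul_pow]
  gcongr
  exact X.le_opENorm _

theorem hsNormSq_adjoint [CompleteSpace K] (X : H →L[ℂ] K) : hsNormSq (adjoint X) = hsNormSq X := by
  unfold hsNormSq
  simp_rw [← tsum_enorm_inner_sq (chosenBasis H), ← tsum_enorm_inner_sq (chosenBasis K)]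
  rw [ENNReal.tsum_comm]
  refine tsum_congr fun i => tsum_congr fun j => ?_
  rw [adjoint_inner_right, ← inner_conj_symm, RCLike.enorm_conj]

theorem norm_abs_apply (B : H →L[ℂ] H) (x : H) : ‖CFC.abs B x‖ = ‖B x‖ := by
  have hs : adjoint (CFC.abs B) = CFC.abs B :=
    ContinuousLinearMap.isSelfAdjoint_iff'.1 (CFC.abs_nonneg B).isSelfAdjoint
  have h : ⟪CFC.abs B x, CFC.abs B x⟫_ℂ = ⟪B x, B x⟫_ℂ :=
    calc ⟪CFC.abs B x, CFC.abs B x⟫_ℂ = ⟪x, (CFC.abs B * CFC.abs B) x⟫_ℂ := by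
          rw [← adjoint_inner_right (CFC.abs B), hs, mul_apply_eq_comp]
      _ = ⟪x, (star B * B) x⟫_ℂ := by rw [CFC.abs_mul_abs]
      _ = ⟪B x, B x⟫_ℂ := adjoint_inner_right B x (B x)
  rw [norm_eq_sqrt_re_inner (𝕜 := ℂ), h, ← norm_eq_sqrt_re_inner]

end Hilbert

section Powers

theorem rpow_tangent_le {s l x : ℝ} (hs : 1 ≤ s) (hl : 0 ≤ l) (hx : 0 ≤ x) :
    s * l ^ (s - 1) * x ≤ x ^ s + (s - 1) * l ^ s := by
  rcases hs.eq_or_lt with rfl | hs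
  · simp
  have : 0 < s := by linarith
  have hs1 : s - 1 ≠ 0 := by linarith
  have young : x * l ^ (s - 1) ≤ x ^ s / s + l ^ s / (s / (s - 1)) := by
    simpa only [← Real.rpow_mul hl, Real.conjExponent, mul_div_cancel₀ _ hs1] using
      Real.young_inequality_of_nonneg hx (Real.rpow_nonneg hl (s - 1))
        (Real.HolderConjugate.conjExponent hs)
  calc s * l ^ (s - 1) * x = s * (x * l ^ (s - 1)) := by ring
    _ ≤ s * (x ^ s / s + l ^ s / (s / (s - 1))) := by gcongr
    _ = x ^ s + (s - 1) * l ^ s := by field_simp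

theorem smul_le_rpow_add_smul_one {A : Type*} [CStarAlgebra A] [PartialOrder A]
    [StarOrderedRing A] {a : A} (ha : 0 ≤ a) {s l : ℝ} (hs : 1 ≤ s) (hl : 0 ≤ l) :
    (s * l ^ (s - 1)) • a ≤ a ^ s + ((s - 1) * l ^ s) • (1 : A) := by
  have hsa : IsSelfAdjoint a := ha.isSelfAdjoint
  have hcont : Continuous fun x : ℝ => x ^ s := Real.continuous_rpow_const (by linarith)
  have hleft : cfc (fun x : ℝ => s * l ^ (s - 1) * x) a = (s * l ^ (s - 1)) • a :=
    cfc_const_mul_id _ a hsa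
  have hright : cfc (fun x : ℝ => x ^ s + (s - 1) * l ^ s) a =
      a ^ s + ((s - 1) * l ^ s) • (1 : A) := by
    rw [cfc_add_const _ _ a hcont.continuousOn, CFC.rpow_eq_cfc_real,
      Algebra.algebraMap_eq_smul_one]
  rw [← hleft, ← hright]
  exact cfc_mono (fun x hx => rpow_tangent_le hs hl (spectrum_nonneg_of_nonneg ha hx))
    (by fun_prop) (hcont.continuousOn.add continuousOn_const)

variable {H : Type*} [NormedAddCommGroup H] [InnerProductSpace ℂ H] [CompleteSpace H]

theorem norm_sqrt_apply_sq {Q : H →L[ℂ] H} (hQ : 0 ≤ Q) (v : H) :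
    ‖CFC.sqrt Q v‖ ^ 2 = (⟪v, Q v⟫_ℂ).re := by
  have hs : adjoint (CFC.sqrt Q) = CFC.sqrt Q :=
    ContinuousLinearMap.isSelfAdjoint_iff'.1 (CFC.sqrt_nonneg Q).isSelfAdjoint
  calc ‖CFC.sqrt Q v‖ ^ 2 = (⟪v, (CFC.sqrt Q * CFC.sqrt Q) v⟫_ℂ).re := by
        rw [mul_apply_eq_comp, ← adjoint_inner_left, hs]
        exact (inner_self_eq_norm_sq (𝕜 := ℂ) _).symm
    _ = (⟪v, Q v⟫_ℂ).re := by rw [CFC.sqrt_mul_sqrt_self Q hQ]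

theorem posTrace_eq_hsNormSq_sqrt {Q : H →L[ℂ] H} (hQ : 0 ≤ Q) :
    posTrace Q = hsNormSq (CFC.sqrt Q) :=
  tsum_congr fun i => by rw [← norm_sqrt_apply_sq hQ, ofReal_norm_sq]

theorem tangent_inner_le_inner_rpow {Q : H →L[ℂ] H} (hQ : 0 ≤ Q) {s l : ℝ} (hs : 1 ≤ s)
    (hl : 0 ≤ l) (v : H) :
    s * l ^ (s - 1) * (⟪v, Q v⟫_ℂ).re ≤
      (⟪v, (Q ^ s) v⟫_ℂ).re + (s - 1) * l ^ s * ‖v‖ ^ 2 := by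
  have hinner : ‖v‖ ^ 2 = (⟪v, v⟫_ℂ).re := (inner_self_eq_norm_sq (𝕜 := ℂ) v).symm
  have h := ((ContinuousLinearMap.le_def _ _).1
    (smul_le_rpow_add_smul_one hQ hs hl)).re_inner_nonneg_right v
  simp only [sub_apply, add_apply, smul_apply, one_apply_eq_self, inner_sub_right,
    inner_add_right, ← Complex.coe_smul, inner_smul_right, RCLike.re_to_complex,
    Complex.sub_re, Complex.add_re, Complex.re_ofReal_mul, ← hinner] at h
  linarith

/-- Jensen's inequality for the spectral measure of `Q` at `v`, obtained from the tangent line of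
`x ↦ x ^ s` at the mean `⟪v, Q v⟫ / ‖v‖ ^ 2`. -/
theorem inner_rpow_le {Q : H →L[ℂ] H} (hQ : 0 ≤ Q) {s : ℝ} (hs : 1 ≤ s) (v : H) :
    (⟪v, Q v⟫_ℂ).re ^ s ≤ (‖v‖ ^ 2) ^ (s - 1) * (⟪v, (Q ^ s) v⟫_ℂ).re := by
  have hs0 : s ≠ 0 := by linarith
  rcases eq_or_ne v 0 with rfl | hv
  · simp [Real.zero_rpow hs0]
  have hn : 0 < ‖v‖ ^ 2 := by positivity
  obtain ⟨l, hl⟩ : ∃ l, (⟪v, Q v⟫_ℂ).re = l * ‖v‖ ^ 2 := ⟨_, (div_mul_cancel₀ _ hn.ne').symm⟩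
  have hl0 : 0 ≤ l := by
    rw [← mul_nonneg_iff_of_pos_right hn, ← hl, ← norm_sqrt_apply_sq hQ]
    positivity
  have hpow : l ^ s = l ^ (s - 1) * l := by
    rw [← Real.rpow_add_one' hl0 (by linarith), sub_add_cancel]
  have htangent : l ^ s * ‖v‖ ^ 2 ≤ (⟪v, (Q ^ s) v⟫_ℂ).re := by
    have h := tangent_inner_le_inner_rpow hQ hs hl0 v
    rw [hl] at h
    rw [hpow] at h ⊢
    linarith
  calc (⟪v, Q v⟫_ℂ).re ^ s = (‖v‖ ^ 2) ^ (s - 1) * (l ^ s * ‖v‖ ^ 2) := by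
        rw [hl, Real.mul_rpow hl0 hn.le, mul_left_comm, ← Real.rpow_add_one hn.ne',
          sub_add_cancel]
    _ ≤ (‖v‖ ^ 2) ^ (s - 1) * (⟪v, (Q ^ s) v⟫_ℂ).re := by gcongr

theorem abs_rpow_nonneg (s : ℝ) (B : H →L[ℂ] H) : 0 ≤ CFC.abs B ^ s :=
  CFC.rpow_nonneg (a := CFC.abs B) (y := s)

/-- The operator `|B| ^ (s / 2)`, encoded as the square root of `|B| ^ s`, so that
`‖absRoot s B v‖ ^ 2 = ⟪v, |B| ^ s v⟫`. -/
def absRoot (s : ℝ) (B : H →L[ℂ] H) : H →L[ℂ] H := CFC.sqrt (CFC.abs B ^ s)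

theorem norm_absRoot_apply_sq (s : ℝ) (B : H →L[ℂ] H) (v : H) :
    ‖absRoot s B v‖ ^ 2 = (⟪v, (CFC.abs B ^ s) v⟫_ℂ).re :=
  norm_sqrt_apply_sq (abs_rpow_nonneg s B) v

theorem adjoint_absRoot (s : ℝ) (B : H →L[ℂ] H) : adjoint (absRoot s B) = absRoot s B :=
  ContinuousLinearMap.isSelfAdjoint_iff'.1 (CFC.sqrt_nonneg _).isSelfAdjoint

theorem absRoot_one_comp_self (B : H →L[ℂ] H) : absRoot 1 B ∘L absRoot 1 B = CFC.abs B := by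
  rw [absRoot, CFC.rpow_one _ (CFC.abs_nonneg _)]
  exact CFC.sqrt_mul_sqrt_self _ (CFC.abs_nonneg B)

theorem norm_absRoot_one_sq_le (B : H →L[ℂ] H) (v : H) :
    ‖absRoot 1 B v‖ ^ 2 ≤ ‖B‖ * ‖v‖ ^ 2 := by
  rw [norm_absRoot_apply_sq, CFC.rpow_one _ (CFC.abs_nonneg _)]
  calc (⟪v, CFC.abs B v⟫_ℂ).re ≤ ‖v‖ * ‖CFC.abs B v‖ :=
        (Complex.re_le_norm _).trans (norm_inner_le_norm _ _)
    _ ≤ ‖v‖ * (‖B‖ * ‖v‖) := by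
        rw [norm_abs_apply]
        gcongr
        exact B.le_opNorm v
    _ = ‖B‖ * ‖v‖ ^ 2 := by ring

theorem norm_absRoot_one_sq_rpow_le (B : H →L[ℂ] H) {s : ℝ} (hs : 1 ≤ s) (v : H) :
    (‖absRoot 1 B v‖ ^ 2) ^ s ≤ (‖v‖ ^ 2) ^ (s - 1) * ‖absRoot s B v‖ ^ 2 := by
  rw [norm_absRoot_apply_sq, norm_absRoot_apply_sq, CFC.rpow_one _ (CFC.abs_nonneg _)]
  exact inner_rpow_le (CFC.abs_nonneg B) hs v

theorem schattenNorm_of_ne_top {r : ℝ≥0∞} (hr : r ≠ ∞) (B : H →L[ℂ] H) :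
    schattenNorm r B = hsNormSq (absRoot r.toReal B) ^ (1 / r.toReal) := by
  rw [schattenNorm, if_neg hr, posTrace_eq_hsNormSq_sqrt (abs_rpow_nonneg _ B), absRoot]

theorem schattenNorm_one (B : H →L[ℂ] H) : schattenNorm 1 B = hsNormSq (absRoot 1 B) := by
  rw [schattenNorm_of_ne_top ENNReal.one_ne_top, ENNReal.toReal_one, div_one, ENNReal.rpow_one]

theorem exists_contraction_comp_abs_eq (B : H →L[ℂ] H) :
    ∃ U : H →L[ℂ] H, ‖U‖ ≤ 1 ∧ U ∘L CFC.abs B = B :=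
  exists_contraction_comp_eq fun x => (norm_abs_apply B x).ge

theorem exists_comp_eq_abs (B : H →L[ℂ] H) : ∃ V : H →L[ℂ] H, V ∘L B = CFC.abs B := by
  obtain ⟨U, hU, hUB⟩ := exists_contraction_comp_abs_eq B
  refine ⟨adjoint U, ?_⟩
  nth_rewrite 1 [← hUB]
  refine adjoint_comp_eq_of_norm_le_one hU fun x => ?_
  rw [norm_abs_apply, ← ContinuousLinearMap.comp_apply, hUB]

end Powers

section Trace

variable {H K : Type*} [NormedAddCommGroup H] [InnerProductSpace ℂ H] [CompleteSpace H]
  [NormedAddCommGroup K] [InnerProductSpace ℂ K] [CompleteSpace K]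

theorem isTraceClass_comp_adjoint {X Y : H →L[ℂ] K} (hX : hsNormSq X < ∞)
    (hY : hsNormSq Y < ∞) : IsTraceClass (X ∘L adjoint Y) := by
  obtain ⟨V, hV⟩ := exists_comp_eq_abs (X ∘L adjoint Y)
  have hVX : hsNormSq (adjoint (V ∘L X)) < ∞ := by
    rw [hsNormSq_adjoint]
    exact (hsNormSq_comp_le_left V X).trans_lt
      (ENNReal.mul_lt_top (ENNReal.pow_lt_top enorm_lt_top) hX)
  have hinner : ∀ v, ⟪v, CFC.abs (X ∘L adjoint Y) v⟫_ℂ = ⟪adjoint (V ∘L X) v, adjoint Y v⟫_ℂ :=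
    fun v => by rw [← hV, adjoint_inner_left]; rfl
  rw [IsTraceClass, schattenNorm_one]
  calc hsNormSq (absRoot 1 (X ∘L adjoint Y))
      ≤ hsNormSq (adjoint (V ∘L X)) + hsNormSq (adjoint Y) := by
        rw [hsNormSq, hsNormSq, hsNormSq, ← ENNReal.tsum_add]
        refine ENNReal.tsum_le_tsum fun i => ?_
        rw [← ofReal_norm_sq, norm_absRoot_apply_sq, CFC.rpow_one _ (CFC.abs_nonneg _), hinner]
        refine le_trans ?_ (enorm_inner_le_sq_add_sq _ _)
        rw [← ofReal_norm]
        exact ENNReal.ofReal_le_ofReal (Complex.re_le_norm _)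
    _ < ∞ := by
        rw [hsNormSq_adjoint Y]
        exact ENNReal.add_lt_top.2 ⟨hVX, hY⟩

theorem summable_inner_mul_inner_of_hsNormSq {X Y : H →L[ℂ] K} (hX : hsNormSq X < ∞)
    (hY : hsNormSq Y < ∞) :
    Summable fun p : basisIndex K × basisIndex H =>
      ⟪Y (chosenBasis H p.2), chosenBasis K p.1⟫_ℂ *
        ⟪chosenBasis K p.1, X (chosenBasis H p.2)⟫_ℂ := by
  refine Summable.of_enorm (ne_top_of_le_ne_top (ENNReal.add_lt_top.2 ⟨hY, hX⟩).ne ?_)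
  rw [hsNormSq, hsNormSq, ← ENNReal.tsum_add, ENNReal.tsum_prod', ENNReal.tsum_comm]
  refine ENNReal.tsum_le_tsum fun j => ?_
  rw [← tsum_enorm_inner_sq (chosenBasis K), ← tsum_enorm_inner_sq (chosenBasis K),
    ← ENNReal.tsum_add]
  refine ENNReal.tsum_le_tsum fun i => ?_
  rw [enorm_mul, ← inner_conj_symm, RCLike.enorm_conj]
  exact mul_le_sq_add_sq _ _

theorem trace_comp_adjoint {X Y : H →L[ℂ] K} (hX : hsNormSq X < ∞) (hY : hsNormSq Y < ∞) :
    trace (X ∘L adjoint Y) = ∑' j, ⟪Y (chosenBasis H j), X (chosenBasis H j)⟫_ℂ := by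
  have hrow (i) : ⟪chosenBasis K i, (X ∘L adjoint Y) (chosenBasis K i)⟫_ℂ =
      ∑' j, ⟪Y (chosenBasis H j), chosenBasis K i⟫_ℂ *
        ⟪chosenBasis K i, X (chosenBasis H j)⟫_ℂ := by
    rw [ContinuousLinearMap.comp_apply, ← adjoint_inner_left X,
      ← (chosenBasis H).tsum_inner_mul_inner]
    simp only [adjoint_inner_left, adjoint_inner_right, mul_comm]
  have hcol (j) : ⟪Y (chosenBasis H j), X (chosenBasis H j)⟫_ℂ =
      ∑' i, ⟪Y (chosenBasis H j), chosenBasis K i⟫_ℂ *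
        ⟪chosenBasis K i, X (chosenBasis H j)⟫_ℂ :=
    ((chosenBasis K).tsum_inner_mul_inner _ _).symm
  simp_rw [trace, hrow, hcol]
  exact (summable_inner_mul_inner_of_hsNormSq hX hY).tsum_comm.symm

end Trace

section LocalDensity

open TopologicalSpace (SeparableSpace)

variable {H : Type*} [NormedAddCommGroup H] [InnerProductSpace ℂ H]

theorem countable_of_orthonormal [SeparableSpace H] {ι : Type*} {v : ι → H}
    (hv : Orthonormal ℂ v) : Countable ι := by
  refine Pairwise.countable_of_isOpen_disjoint (s := fun i => Metric.ball (v i) (1 / 2))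
    (fun i j hij => Metric.ball_disjoint_ball ?_) (fun i => Metric.isOpen_ball)
    (fun i => Metric.nonempty_ball.2 (by norm_num))
  have hdist := @norm_sub_sq ℂ H _ _ _ (v i) (v j)
  rw [hv.1, hv.1, hv.2 hij, map_zero] at hdist
  rw [dist_eq_norm]
  nlinarith [norm_nonneg (v i - v j)]

variable [CompleteSpace H]

instance countable_basisIndex [SeparableSpace H] : Countable (basisIndex H) :=
  countable_of_orthonormal (chosenBasis H).orthonormal

variable {α : Type*} [MeasurableSpace α] {μ : Measure α}

theorem measurable_coe_Lp (f : Lp ℂ 2 μ) : Measurable (f : α → ℂ) :=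
  (Lp.stronglyMeasurable f).measurable

theorem enorm_sq_eq_lintegral (f : Lp ℂ 2 μ) : ‖f‖ₑ ^ 2 = ∫⁻ x, ‖f x‖ₑ ^ 2 ∂μ := by
  rw [Lp.enorm_def]
  simpa using eLpNorm_nnreal_pow_eq_lintegral (f := f) (μ := μ) (p := 2) two_ne_zero

/-- The density `x ↦ ∑ᵢ |X eᵢ (x)|²` of the operator `X X*` on `L²(μ)`. -/
def localDensity (X : H →L[ℂ] Lp ℂ 2 μ) (x : α) : ℝ≥0∞ :=
  ∑' i, ‖X (chosenBasis H i) x‖ₑ ^ 2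

/-- The density `x ↦ ∑ᵢ X eᵢ (x) conj (Y eᵢ (x))` of the operator `X Y*` on `L²(μ)`. -/
def pairDensity (X Y : H →L[ℂ] Lp ℂ 2 μ) (x : α) : ℂ :=
  ∑' i, ⟪Y (chosenBasis H i) x, X (chosenBasis H i) x⟫_ℂ

theorem tsum_enorm_inner_le (X Y : H →L[ℂ] Lp ℂ 2 μ) (x : α) :
    ∑' i, ‖⟪Y (chosenBasis H i) x, X (chosenBasis H i) x⟫_ℂ‖ₑ ≤
      localDensity X x + localDensity Y x := by
  rw [localDensity, localDensity, ← ENNReal.tsum_add]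
  refine ENNReal.tsum_le_tsum fun i => ?_
  rw [add_comm]
  exact enorm_inner_le_sq_add_sq _ _

theorem enorm_pairDensity_le (X Y : H →L[ℂ] Lp ℂ 2 μ) (x : α) :
    ‖pairDensity X Y x‖ₑ ≤ localDensity X x + localDensity Y x :=
  enorm_tsum_le_tsum_enorm.trans (tsum_enorm_inner_le X Y x)

variable [SeparableSpace H]

theorem measurable_localDensity (X : H →L[ℂ] Lp ℂ 2 μ) : Measurable (localDensity X) :=
  Measurable.tsum fun _ => (measurable_coe_Lp _).enorm.pow_const 2

theorem measurable_pairDensity (X Y : H →L[ℂ] Lp ℂ 2 μ) : Measurable (pairDensity X Y) :=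
  Measurable.tsum fun _ => (measurable_coe_Lp _).inner (measurable_coe_Lp _)

theorem setLIntegral_localDensity (X : H →L[ℂ] Lp ℂ 2 μ) (S : Set α) :
    ∫⁻ x in S, localDensity X x ∂μ = ∑' i, ∫⁻ x in S, ‖X (chosenBasis H i) x‖ₑ ^ 2 ∂μ :=
  lintegral_tsum fun _ => ((measurable_coe_Lp _).enorm.pow_const 2).aemeasurable

theorem lintegral_localDensity (X : H →L[ℂ] Lp ℂ 2 μ) :
    ∫⁻ x, localDensity X x ∂μ = hsNormSq X := by
  rw [← setLIntegral_univ, setLIntegral_localDensity]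
  exact tsum_congr fun i => by rw [setLIntegral_univ, ← enorm_sq_eq_lintegral]

theorem setLIntegral_localDensity_add_lt_top {X Y : H →L[ℂ] Lp ℂ 2 μ} {S : Set α}
    (hX : ∫⁻ x in S, localDensity X x ∂μ < ∞) (hY : ∫⁻ x in S, localDensity Y x ∂μ < ∞) :
    ∫⁻ x in S, localDensity X x + localDensity Y x ∂μ < ∞ := by
  rw [lintegral_add_left (measurable_localDensity X)]
  exact ENNReal.add_lt_top.2 ⟨hX, hY⟩

theorem integrableOn_pairDensity {X Y : H →L[ℂ] Lp ℂ 2 μ} {S : Set α}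
    (hX : ∫⁻ x in S, localDensity X x ∂μ < ∞) (hY : ∫⁻ x in S, localDensity Y x ∂μ < ∞) :
    IntegrableOn (pairDensity X Y) S μ :=
  ⟨(measurable_pairDensity X Y).aestronglyMeasurable,
    (lintegral_mono (enorm_pairDensity_le X Y)).trans_lt
      (setLIntegral_localDensity_add_lt_top hX hY)⟩

theorem setIntegral_pairDensity {X Y : H →L[ℂ] Lp ℂ 2 μ} {S : Set α}
    (hX : ∫⁻ x in S, localDensity X x ∂μ < ∞) (hY : ∫⁻ x in S, localDensity Y x ∂μ < ∞) :
    ∫ x in S, pairDensity X Y x ∂μ =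
      ∑' i, ∫ x in S, ⟪Y (chosenBasis H i) x, X (chosenBasis H i) x⟫_ℂ ∂μ := by
  have hmeas (i) : Measurable fun x => ⟪Y (chosenBasis H i) x, X (chosenBasis H i) x⟫_ℂ :=
    (measurable_coe_Lp _).inner (measurable_coe_Lp _)
  refine integral_tsum (fun i => (hmeas i).aestronglyMeasurable) ?_
  rw [← lintegral_tsum fun i => (hmeas i).enorm.aemeasurable]
  exact ((lintegral_mono (tsum_enorm_inner_le X Y)).trans_lt
    (setLIntegral_localDensity_add_lt_top hX hY)).ne

end LocalDensity

section Multiplication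

theorem mulCLM_ae (m : E3 → ℂ) (hm : Measurable m) (hb : ∀ x, ‖m x‖ ≤ 1) (f : L2) :
    mulCLM m hm hb f =ᵐ[volume] fun x => m x * f x :=
  MemLp.coeFn_toLp (memLp_mul_bounded hm hb f)

theorem norm_mulCLM_le {m : E3 → ℂ} (hm : Measurable m) (hb : ∀ x, ‖m x‖ ≤ 1) {a : ℝ}
    (ha : 0 ≤ a) (h : ∀ x, ‖m x‖ ≤ a) : ‖mulCLM m hm hb‖ ≤ a := by
  refine ContinuousLinearMap.opNorm_le_bound _ ha fun f => Lp.norm_le_mul_norm_of_ae_le_mul ?_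
  filter_upwards [mulCLM_ae m hm hb f] with x hx
  rw [hx, norm_mul]
  gcongr
  exact h x

theorem mulCLM_comm {m n : E3 → ℂ} (hm : Measurable m) (hbm : ∀ x, ‖m x‖ ≤ 1)
    (hn : Measurable n) (hbn : ∀ x, ‖n x‖ ≤ 1) :
    mulCLM m hm hbm ∘L mulCLM n hn hbn = mulCLM n hn hbn ∘L mulCLM m hm hbm := by
  refine ContinuousLinearMap.ext fun f => Lp.ext ?_
  filter_upwards [mulCLM_ae m hm hbm (mulCLM n hn hbn f), mulCLM_ae n hn hbn f,
    mulCLM_ae n hn hbn (mulCLM m hm hbm f), mulCLM_ae m hm hbm f] with x h₁ h₂ h₃ h₄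
  rw [ContinuousLinearMap.comp_apply, ContinuousLinearMap.comp_apply, h₁, h₂, h₃, h₄,
    mul_left_comm]

theorem adjoint_mulCLM_of_conj_eq {m : E3 → ℂ} (hm : Measurable m) (hb : ∀ x, ‖m x‖ ≤ 1)
    (hreal : ∀ x, starRingEnd ℂ (m x) = m x) : adjoint (mulCLM m hm hb) = mulCLM m hm hb := by
  refine ((ContinuousLinearMap.eq_adjoint_iff _ _).2 fun f g => ?_).symm
  rw [L2.inner_def, L2.inner_def]
  refine integral_congr_ae ?_
  filter_upwards [mulCLM_ae m hm hb f, mulCLM_ae m hm hb g] with x hf hg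
  simp only [hf, hg, RCLike.inner_apply, map_mul, hreal]
  ring

theorem cutoff_ae (S : Set E3) (hS : MeasurableSet S) (f : L2) :
    cutoff S hS f =ᵐ[volume] S.indicator f := by
  filter_upwards [mulCLM_ae _ (measurable_const.indicator hS) (norm_indicator_one_le S) f]
    with x hx
  rw [cutoff, hx]
  by_cases h : x ∈ S <;> simp [h]

theorem adjoint_cutoff (S : Set E3) (hS : MeasurableSet S) :
    adjoint (cutoff S hS) = cutoff S hS :=
  adjoint_mulCLM_of_conj_eq _ _ fun x => by by_cases hx : x ∈ S <;> simp [hx]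

theorem enorm_cutoff_sq (S : Set E3) (hS : MeasurableSet S) (f : L2) :
    ‖cutoff S hS f‖ₑ ^ 2 = ∫⁻ x in S, ‖f x‖ₑ ^ 2 := by
  rw [enorm_sq_eq_lintegral, ← lintegral_indicator hS]
  refine lintegral_congr_ae ?_
  filter_upwards [cutoff_ae S hS f] with x hx
  rw [hx]
  by_cases h : x ∈ S <;> simp [h]

theorem inner_cutoff (S : Set E3) (hS : MeasurableSet S) (f g : L2) :
    ⟪cutoff S hS f, cutoff S hS g⟫_ℂ = ∫ x in S, ⟪f x, g x⟫_ℂ := by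
  rw [L2.inner_def, ← integral_indicator hS]
  refine integral_congr_ae ?_
  filter_upwards [cutoff_ae S hS f, cutoff_ae S hS g] with x hx hy
  rw [hx, hy]
  by_cases h : x ∈ S <;> simp [h]

end Multiplication

section Density

instance secondCountableTopology_L2 : SecondCountableTopology L2 :=
  have : Fact ((2 : ℝ≥0∞) ≠ ∞) := ⟨ENNReal.ofNat_ne_top⟩
  Lp.SecondCountableTopology

variable {H : Type*} [NormedAddCommGroup H] [InnerProductSpace ℂ H] [CompleteSpace H]
  [TopologicalSpace.SeparableSpace H]

theorem hsNormSq_cutoff_comp (X : H →L[ℂ] L2) (S : Set E3) (hS : MeasurableSet S) :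
    hsNormSq (cutoff S hS ∘L X) = ∫⁻ x in S, localDensity X x := by
  rw [setLIntegral_localDensity]
  exact tsum_congr fun i => enorm_cutoff_sq S hS _

theorem isTraceClass_cutoff_and_trace_eq {X Y : H →L[ℂ] L2} {S : Set E3}
    (hS : MeasurableSet S) (hX : ∫⁻ x in S, localDensity X x < ∞)
    (hY : ∫⁻ x in S, localDensity Y x < ∞) :
    IsTraceClass (cutoff S hS ∘L (X ∘L adjoint Y) ∘L cutoff S hS) ∧
      trace (cutoff S hS ∘L (X ∘L adjoint Y) ∘L cutoff S hS) =
        ∫ x in S, pairDensity X Y x := by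
  have hcomp : cutoff S hS ∘L (X ∘L adjoint Y) ∘L cutoff S hS =
      (cutoff S hS ∘L X) ∘L adjoint (cutoff S hS ∘L Y) := by
    rw [ContinuousLinearMap.adjoint_comp, adjoint_cutoff]
    rfl
  have hX' := hX
  have hY' := hY
  rw [← hsNormSq_cutoff_comp X S hS] at hX'
  rw [← hsNormSq_cutoff_comp Y S hS] at hY'
  rw [hcomp]
  refine ⟨isTraceClass_comp_adjoint hX' hY', ?_⟩
  rw [trace_comp_adjoint hX' hY', setIntegral_pairDensity hX hY]
  exact tsum_congr fun i => inner_cutoff S hS _ _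

theorem isDensity_pairDensity (ħ : ℝ) {X Y : H →L[ℂ] L2}
    (hX : ∀ S : Set E3, Bornology.IsBounded S → ∫⁻ x in S, localDensity X x < ∞)
    (hY : ∀ S : Set E3, Bornology.IsBounded S → ∫⁻ x in S, localDensity Y x < ∞) :
    IsDensity ħ (X ∘L adjoint Y)
      (fun x => (((2 * Real.pi * ħ) ^ 3 : ℝ) : ℂ) * pairDensity X Y x) := by
  refine ⟨LocallyIntegrable.smul (𝕜 := ℂ) (fun x => ?_) _, fun S hS hb => ?_⟩
  · exact ⟨Metric.ball x 1, Metric.ball_mem_nhds x one_pos, integrableOn_pairDensity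
      (hX _ Metric.isBounded_ball) (hY _ Metric.isBounded_ball)⟩
  · have h := isTraceClass_cutoff_and_trace_eq hS (hX S hb) (hY S hb)
    exact ⟨h.1, by rw [h.2, integral_const_mul]⟩

theorem IsDensity.ae_eq {ħ : ℝ} {A : L2 →L[ℂ] L2} {ρ ρ' : E3 → ℂ} (h : IsDensity ħ A ρ)
    (h' : IsDensity ħ A ρ') : ρ =ᵐ[volume] ρ' := by
  rw [← sub_ae_eq_zero]
  refine ae_eq_zero_of_forall_setIntegral_isCompact_eq_zero' (h.1.sub h'.1) fun S hS => ?_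
  rw [integral_sub' (h.1.integrableOn_isCompact hS) (h'.1.integrableOn_isCompact hS),
    (h.2 S hS.measurableSet hS.isBounded).2, (h'.2 S hS.measurableSet hS.isBounded).2, sub_self]

end Density

section Summation

variable {α : Type*} [MeasurableSpace α] {μ : Measure α}

theorem eLpNorm_tsum_le {f : ℕ → α → ℝ≥0∞} (hf : ∀ k, Measurable (f k)) {p : ℝ≥0∞} (hp : 1 ≤ p) :
    eLpNorm (fun x => ∑' k, f k x) p μ ≤ ∑' k, eLpNorm (f k) p μ := by
  have hp₀ : p ≠ 0 := (zero_lt_one.trans_le hp).ne'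
  rcases eq_or_ne p ∞ with rfl | hp_top
  · simp only [eLpNorm_exponent_top]
    refine essSup_le_of_ae_le _ ?_
    filter_upwards [ae_all_iff.2 fun k => ae_le_eLpNormEssSup (f := f k) (μ := μ)] with x hx
    exact ENNReal.tsum_le_tsum hx
  · have hp_pos : 0 < p.toReal := ENNReal.toReal_pos hp₀ hp_top
    have hpartial (n : ℕ) : ∫⁻ x, (∑ k ∈ Finset.range n, f k x) ^ p.toReal ∂μ ≤
        (∑' k, eLpNorm (f k) p μ) ^ p.toReal := by
      have hsum := (eLpNorm_sum_le (s := Finset.range n)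
        (fun k _ => (hf k).aestronglyMeasurable (μ := μ)) hp).trans (ENNReal.sum_le_tsum _)
      rw [eLpNorm_eq_lintegral_rpow_enorm_toReal hp₀ hp_top, one_div,
        ENNReal.rpow_inv_le_iff hp_pos] at hsum
      simpa using hsum
    rw [eLpNorm_eq_lintegral_rpow_enorm_toReal hp₀ hp_top, one_div, ENNReal.rpow_inv_le_iff hp_pos]
    refine le_of_tendsto' (lintegral_tendsto_of_tendsto_of_monotone
      (fun n => ((Finset.measurable_fun_sum _ fun k _ => hf k).pow_const _).aemeasurable)
      (.of_forall fun x m n hmn => ?_) (.of_forall fun x => ?_)) hpartial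
    · exact ENNReal.rpow_le_rpow
        (Finset.sum_le_sum_of_subset (Finset.range_mono hmn)) hp_pos.le
    · exact (ENNReal.continuous_rpow_const.tendsto _).comp (ENNReal.tendsto_nat_tsum fun k => f k x)

theorem tsum_sq_le_tsum_mul_tsum (b : ℕ → ℝ≥0∞) {c : ℕ → ℝ≥0∞} (hc : ∀ k, c k ≠ 0)
    (hc' : ∀ k, c k ≠ ∞) :
    (∑' k, b k) ^ 2 ≤ (∑' k, c k) * ∑' k, (c k)⁻¹ * b k ^ 2 := by
  have hsplit (k) : c k ^ (2⁻¹ : ℝ) * ((c k)⁻¹ ^ (2⁻¹ : ℝ) * b k) = b k := by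
    rw [← mul_assoc, ← ENNReal.mul_rpow_of_nonneg _ _ (by norm_num),
      ENNReal.mul_inv_cancel (hc k) (hc' k), ENNReal.one_rpow, one_mul]
  have hholder := ENNReal.lintegral_mul_le_Lp_mul_Lq Measure.count Real.HolderConjugate.two_two
    (Measurable.of_discrete (f := fun k => c k ^ (2⁻¹ : ℝ))).aemeasurable
    (Measurable.of_discrete (f := fun k => (c k)⁻¹ ^ (2⁻¹ : ℝ) * b k)).aemeasurable
  simp only [lintegral_count, Pi.mul_apply, hsplit, ENNReal.rpow_two, mul_pow,
    one_div] at hholder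
  have hsqrt (x : ℝ≥0∞) : (x ^ (2⁻¹ : ℝ)) ^ 2 = x := by
    rw [← ENNReal.rpow_two, ENNReal.rpow_inv_rpow two_ne_zero]
  simp only [hsqrt] at hholder
  calc (∑' k, b k) ^ 2
      ≤ ((∑' k, c k) ^ (2⁻¹ : ℝ) * (∑' k, (c k)⁻¹ * b k ^ 2) ^ (2⁻¹ : ℝ)) ^ 2 := by gcongr
    _ = (∑' k, c k) * ∑' k, (c k)⁻¹ * b k ^ 2 := by rw [mul_pow, hsqrt, hsqrt]

theorem tsum_ofReal_pow {p : ℝ} (hp₀ : 0 ≤ p) (hp₁ : p < 1) :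
    ∑' k : ℕ, ENNReal.ofReal (p ^ k) = ENNReal.ofReal (1 - p)⁻¹ := by
  rw [← ENNReal.ofReal_tsum_of_nonneg (fun k => by positivity)
    (summable_geometric_of_lt_one hp₀ hp₁), tsum_geometric_of_lt_one hp₀ hp₁]

theorem eLpNorm_const_mul_le {c : ℝ≥0∞} {f : α → ℝ≥0∞} (hf : Measurable f) (p : ℝ≥0∞) :
    eLpNorm (fun x => c * f x) p μ ≤ c * eLpNorm f p μ :=
  eLpNorm_le_mul_eLpNorm_of_ae_le_mul'' p hf.aestronglyMeasurable (.of_forall fun _ => le_rfl)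

variable {H : Type*} [NormedAddCommGroup H] [InnerProductSpace ℂ H] [CompleteSpace H]
  [TopologicalSpace.SeparableSpace H]

theorem localDensity_ae_le_tsum {X : H →L[ℂ] Lp ℂ 2 μ} {Xₖ : ℕ → H →L[ℂ] Lp ℂ 2 μ}
    (hX : ∀ f, ∀ᵐ x ∂μ, ‖X f x‖ₑ ≤ ∑' k, ‖Xₖ k f x‖ₑ)
    {c : ℕ → ℝ≥0∞} (hc : ∀ k, c k ≠ 0) (hc' : ∀ k, c k ≠ ∞) :
    ∀ᵐ x ∂μ, localDensity X x ≤ (∑' k, c k) * ∑' k, (c k)⁻¹ * localDensity (Xₖ k) x := by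
  filter_upwards [ae_all_iff.2 fun i => hX (chosenBasis H i)] with x hx
  calc localDensity X x
      ≤ ∑' i, (∑' k, c k) * ∑' k, (c k)⁻¹ * ‖Xₖ k (chosenBasis H i) x‖ₑ ^ 2 := by
        refine ENNReal.tsum_le_tsum fun i => le_trans ?_ (tsum_sq_le_tsum_mul_tsum _ hc hc')
        gcongr
        exact hx i
    _ = (∑' k, c k) * ∑' k, (c k)⁻¹ * localDensity (Xₖ k) x := by
        rw [ENNReal.tsum_mul_left, ENNReal.tsum_comm]
        simp_rw [ENNReal.tsum_mul_left]
        rfl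

/- The rate `p²` is split as `p · p`: one factor weights the Cauchy–Schwarz inequality, and the
other one remains summable. -/
theorem eLpNorm_localDensity_le_of_geometric {X : H →L[ℂ] Lp ℂ 2 μ}
    {Xₖ : ℕ → H →L[ℂ] Lp ℂ 2 μ} (hX : ∀ f, ∀ᵐ x ∂μ, ‖X f x‖ₑ ≤ ∑' k, ‖Xₖ k f x‖ₑ)
    {p : ℝ} (hp₀ : 0 < p) (hp₁ : p < 1) {r N : ℝ≥0∞} (hr : 1 ≤ r)
    (hN : ∀ k, eLpNorm (localDensity (Xₖ k)) r μ ≤ ENNReal.ofReal ((p ^ 2) ^ k) * N) :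
    eLpNorm (localDensity X) r μ ≤ ENNReal.ofReal ((1 - p)⁻¹ ^ 2) * N := by
  have hc (k : ℕ) : ENNReal.ofReal (p ^ k) ≠ 0 := (ENNReal.ofReal_pos.2 (by positivity)).ne'
  have hmeas (k) : Measurable fun x => (ENNReal.ofReal (p ^ k))⁻¹ * localDensity (Xₖ k) x :=
    (measurable_localDensity _).const_mul _
  have hterm (k : ℕ) :
      eLpNorm (fun x => (ENNReal.ofReal (p ^ k))⁻¹ * localDensity (Xₖ k) x) r μ ≤
        ENNReal.ofReal (p ^ k) * N := by
    refine (eLpNorm_const_mul_le (measurable_localDensity _) r).trans ?_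
    refine (mul_le_mul_right (hN k) _).trans_eq ?_
    rw [← mul_assoc, ← pow_mul, mul_comm 2, pow_mul, sq, ENNReal.ofReal_mul (by positivity),
      ← mul_assoc, ENNReal.inv_mul_cancel (hc k) ENNReal.ofReal_ne_top, one_mul]
  calc eLpNorm (localDensity X) r μ
      ≤ eLpNorm (fun x => ENNReal.ofReal (1 - p)⁻¹ *
          ∑' k, (ENNReal.ofReal (p ^ k))⁻¹ * localDensity (Xₖ k) x) r μ := by
        refine eLpNorm_mono_enorm_ae ?_
        simpa only [tsum_ofReal_pow hp₀.le hp₁, enorm_eq_self] using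
          localDensity_ae_le_tsum hX hc fun k => ENNReal.ofReal_ne_top
    _ ≤ ENNReal.ofReal (1 - p)⁻¹ * ∑' k : ℕ, ENNReal.ofReal (p ^ k) * N := by
        refine (eLpNorm_const_mul_le (Measurable.tsum hmeas) r).trans ?_
        gcongr
        exact (eLpNorm_tsum_le hmeas hr).trans (ENNReal.tsum_le_tsum hterm)
    _ = ENNReal.ofReal ((1 - p)⁻¹ ^ 2) * N := by
        rw [ENNReal.tsum_mul_right, tsum_ofReal_pow hp₀.le hp₁, ← mul_assoc, ← sq,
          ENNReal.ofReal_pow (inv_nonneg.2 (by linarith))]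

end Summation

section Carleman

variable {α : Type*} [MeasurableSpace α] {μ : Measure α}
variable {H : Type*} [NormedAddCommGroup H] [InnerProductSpace ℂ H] [CompleteSpace H]

theorem hsNormSq_comp_le_of_norm_le {T : H →L[ℂ] Lp ℂ 2 μ} {a : ℝ} (hT : ‖T‖ ≤ a)
    (Y : H →L[ℂ] H) : hsNormSq (T ∘L Y) ≤ ENNReal.ofReal (a ^ 2) * hsNormSq Y := by
  refine (hsNormSq_comp_le_left T Y).trans ?_
  rw [← ofReal_norm_sq]
  gcongr

/-- `T` is a Carleman operator with kernel `K`: the value of `T f` at almost every point `x` is the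
inner product of `f` with the vector `K x` of `H`. -/
def IsCarlemanKernel (T : H →L[ℂ] Lp ℂ 2 μ) (K : α → H) : Prop :=
  ∀ f, T f =ᵐ[μ] fun x => ⟪K x, f⟫_ℂ

theorem IsCarlemanKernel.comp {T : H →L[ℂ] Lp ℂ 2 μ} {K : α → H} (hK : IsCarlemanKernel T K)
    (Y : H →L[ℂ] H) : IsCarlemanKernel (T ∘L Y) fun x => adjoint Y (K x) := fun f => by
  simpa only [ContinuousLinearMap.comp_apply, adjoint_inner_left] using hK (Y f)

variable [TopologicalSpace.SeparableSpace H]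

theorem IsCarlemanKernel.localDensity_ae_eq {T : H →L[ℂ] Lp ℂ 2 μ} {K : α → H}
    (hK : IsCarlemanKernel T K) : localDensity T =ᵐ[μ] fun x => ENNReal.ofReal (‖K x‖ ^ 2) := by
  filter_upwards [ae_all_iff.2 fun i => hK (chosenBasis H i)] with x hx
  rw [ofReal_norm_sq, ← tsum_enorm_inner_sq (chosenBasis H)]
  refine tsum_congr fun i => ?_
  rw [hx, ← inner_conj_symm, RCLike.enorm_conj]

theorem IsCarlemanKernel.localDensity_comp_absRoot_ae_eq {T : H →L[ℂ] Lp ℂ 2 μ} {K : α → H}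
    (hK : IsCarlemanKernel T K) (s : ℝ) (B : H →L[ℂ] H) :
    localDensity (T ∘L absRoot s B) =ᵐ[μ] fun x => ENNReal.ofReal (‖absRoot s B (K x)‖ ^ 2) := by
  simpa only [adjoint_absRoot] using (hK.comp (absRoot s B)).localDensity_ae_eq

theorem eLpNorm_one_localDensity_absRoot_le {T : H →L[ℂ] Lp ℂ 2 μ} {a : ℝ} (hT : ‖T‖ ≤ a)
    (B : H →L[ℂ] H) :
    eLpNorm (localDensity (T ∘L absRoot 1 B)) 1 μ ≤ ENNReal.ofReal (a ^ 2) * schattenNorm 1 B := by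
  rw [schattenNorm_one, eLpNorm_one_eq_lintegral_enorm]
  simpa only [enorm_eq_self, lintegral_localDensity] using hsNormSq_comp_le_of_norm_le hT _

theorem eLpNorm_top_localDensity_absRoot_le {T : H →L[ℂ] Lp ℂ 2 μ} {K : α → H}
    (hK : IsCarlemanKernel T K) {M : ℝ} (hM : ∀ x, ‖K x‖ ≤ M) (B : H →L[ℂ] H) :
    eLpNorm (localDensity (T ∘L absRoot 1 B)) ∞ μ ≤
      ENNReal.ofReal (M ^ 2) * schattenNorm ∞ B := by
  rw [schattenNorm, if_pos rfl, eLpNorm_exponent_top]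
  refine essSup_le_of_ae_le _ ?_
  filter_upwards [hK.localDensity_comp_absRoot_ae_eq 1 B] with x hx
  rw [enorm_eq_self, hx, ← ofReal_norm, ← ENNReal.ofReal_mul (by positivity)]
  refine ENNReal.ofReal_le_ofReal ((norm_absRoot_one_sq_le B (K x)).trans ?_)
  rw [mul_comm]
  gcongr
  exact hM x

theorem lintegral_localDensity_absRoot_rpow_le {T : H →L[ℂ] Lp ℂ 2 μ} {K : α → H}
    (hK : IsCarlemanKernel T K) {M : ℝ} (hM : ∀ x, ‖K x‖ ≤ M) {s : ℝ} (hs : 1 ≤ s)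
    (B : H →L[ℂ] H) :
    ∫⁻ x, localDensity (T ∘L absRoot 1 B) x ^ s ∂μ ≤
      ENNReal.ofReal ((M ^ 2) ^ (s - 1)) * hsNormSq (T ∘L absRoot s B) := by
  rw [← lintegral_localDensity, ← lintegral_const_mul _ (measurable_localDensity _)]
  refine lintegral_mono_ae ?_
  filter_upwards [hK.localDensity_comp_absRoot_ae_eq 1 B, hK.localDensity_comp_absRoot_ae_eq s B]
    with x h₁ hₛ
  rw [h₁, hₛ, ENNReal.ofReal_rpow_of_nonneg (by positivity) (by linarith),
    ← ENNReal.ofReal_mul (by positivity)]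
  refine ENNReal.ofReal_le_ofReal ((norm_absRoot_one_sq_rpow_le B hs _).trans ?_)
  gcongr
  exact hM x

theorem toReal_inv_eq_one_sub (r r' : ℝ≥0∞) [hrr : ENNReal.HolderConjugate r r'] :
    (r⁻¹).toReal = 1 - (r'⁻¹).toReal := by
  rw [eq_sub_iff_add_eq, ← ENNReal.toReal_add
    (ENNReal.inv_ne_top.2 (zero_lt_one.trans_le hrr.one_le).ne')
    (ENNReal.inv_ne_top.2 (zero_lt_one.trans_le hrr.symm.one_le).ne'),
    ENNReal.HolderConjugate.inv_add_inv_eq_one r r', ENNReal.toReal_one]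

theorem eLpNorm_localDensity_absRoot_le {r r' : ℝ≥0∞} [hrr : ENNReal.HolderConjugate r r']
    {T : H →L[ℂ] Lp ℂ 2 μ} {a M : ℝ} (hT : ‖T‖ ≤ a) {K : α → H} (hK : IsCarlemanKernel T K)
    (hM : ∀ x, ‖K x‖ ≤ M) (B : H →L[ℂ] H) :
    eLpNorm (localDensity (T ∘L absRoot 1 B)) r μ ≤
      ENNReal.ofReal ((M ^ 2) ^ (r'⁻¹).toReal * (a ^ 2) ^ (r⁻¹).toReal) * schattenNorm r B := by
  rcases eq_or_ne r ∞ with rfl | hr_top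
  · have hr : ((∞ : ℝ≥0∞)⁻¹).toReal = 0 := by simp
    have hr' : (r'⁻¹).toReal = 1 := by linarith [toReal_inv_eq_one_sub ∞ r']
    rw [hr, hr', Real.rpow_one, Real.rpow_zero, mul_one]
    exact eLpNorm_top_localDensity_absRoot_le hK hM B
  set s := r.toReal with hs_def
  have hs : 1 ≤ s := by simpa using ENNReal.toReal_mono hr_top hrr.one_le
  have hα : (r⁻¹).toReal = 1 / s := by rw [ENNReal.toReal_inv, one_div]
  have hα' : (r'⁻¹).toReal = (s - 1) * (1 / s) := by
    have hsub : (s - 1) * (1 / s) = 1 - 1 / s := by field_simp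
    linarith [toReal_inv_eq_one_sub r r']
  rw [schattenNorm_of_ne_top hr_top, eLpNorm_eq_lintegral_rpow_enorm_toReal
    (zero_lt_one.trans_le hrr.one_le).ne' hr_top, ← hs_def]
  simp only [enorm_eq_self]
  calc (∫⁻ x, localDensity (T ∘L absRoot 1 B) x ^ s ∂μ) ^ (1 / s)
      ≤ (ENNReal.ofReal ((M ^ 2) ^ (s - 1)) *
          (ENNReal.ofReal (a ^ 2) * hsNormSq (absRoot s B))) ^ (1 / s) := by
        gcongr
        refine (lintegral_localDensity_absRoot_rpow_le hK hM hs B).trans ?_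
        gcongr
        exact hsNormSq_comp_le_of_norm_le hT _
    _ = ENNReal.ofReal ((M ^ 2) ^ (r'⁻¹).toReal * (a ^ 2) ^ (r⁻¹).toReal) *
          hsNormSq (absRoot s B) ^ (1 / s) := by
        rw [← mul_assoc, ← ENNReal.ofReal_mul (by positivity),
          ENNReal.mul_rpow_of_nonneg _ _ (by positivity),
          ENNReal.ofReal_rpow_of_nonneg (by positivity) (by positivity),
          Real.mul_rpow (by positivity) (by positivity), ← Real.rpow_mul (by positivity), hα, hα']

end Carleman

section BoundedKernel

/-- On integrable functions, `V` is the integral operator with kernel `k`, and `|k| ≤ κ`. -/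
structure IsBoundedKernel (V : L2 →L[ℂ] L2) (k : E3 → E3 → ℂ) (κ : ℝ) : Prop where
  measurable : ∀ x, Measurable (k x)
  norm_le : ∀ x y, ‖k x y‖ ≤ κ
  apply_ae : ∀ g : L2, Integrable g volume → V g =ᵐ[volume] fun x => ∫ y, k x y * g y

variable {α : Type*} [MeasurableSpace α] {μ : Measure α}

theorem eLpNorm_two_le_of_support_subset {h : α → ℂ} {E : Set α} {C : ℝ} (hC : ∀ x, ‖h x‖ ≤ C)
    (hsupp : Function.support h ⊆ E) : eLpNorm h 2 μ ≤ μ E ^ (2⁻¹ : ℝ) * ENNReal.ofReal C := by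
  rw [← eLpNorm_restrict_eq_of_support_subset hsupp]
  simpa using eLpNorm_le_of_ae_bound (p := 2) (μ := μ.restrict E) (.of_forall hC)

theorem memLp_two_of_support_subset {h : α → ℂ} (hm : Measurable h) {E : Set α} (hE : μ E ≠ ∞)
    {C : ℝ} (hC : ∀ x, ‖h x‖ ≤ C) (hsupp : Function.support h ⊆ E) : MemLp h 2 μ :=
  ⟨hm.aestronglyMeasurable, (eLpNorm_two_le_of_support_subset hC hsupp).trans_lt
    (ENNReal.mul_lt_top (ENNReal.rpow_lt_top_of_nonneg (by norm_num) hE) ENNReal.ofReal_lt_top)⟩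

theorem norm_toLp_le_of_support_subset {h : α → ℂ} (hh : MemLp h 2 μ) {E : Set α} (hE : μ E ≠ ∞)
    {C : ℝ} (hC₀ : 0 ≤ C) (hC : ∀ x, ‖h x‖ ≤ C) (hsupp : Function.support h ⊆ E) :
    ‖hh.toLp h‖ ≤ √(μ.real E) * C := by
  rw [Lp.norm_toLp, Real.sqrt_eq_rpow, one_div]
  refine (ENNReal.toReal_mono (ENNReal.mul_ne_top (ENNReal.rpow_ne_top_of_nonneg (by norm_num) hE)
    ENNReal.ofReal_ne_top) (eLpNorm_two_le_of_support_subset hC hsupp)).trans_eq ?_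
  rw [ENNReal.toReal_mul, ← ENNReal.toReal_rpow, ENNReal.toReal_ofReal hC₀, Measure.real]

theorem IsBoundedKernel.exists_isCarlemanKernel {V : L2 →L[ℂ] L2} {k : E3 → E3 → ℂ} {κ : ℝ}
    (hk : IsBoundedKernel V k κ) {m : E3 → ℂ} (hm : Measurable m) (hb : ∀ x, ‖m x‖ ≤ 1)
    {E : Set E3} (hE : volume E ≠ ∞) {a : ℝ} (ha : ∀ x, ‖m x‖ ≤ a)
    (hsupp : Function.support m ⊆ E) :
    ∃ K, IsCarlemanKernel (V ∘L mulCLM m hm hb) K ∧ ∀ x, ‖K x‖ ≤ √(volume.real E) * (κ * a) := by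
  have hκ : 0 ≤ κ := (norm_nonneg _).trans (hk.norm_le 0 0)
  have ha₀ : 0 ≤ a := (norm_nonneg _).trans (ha 0)
  have hmeas (x : E3) : Measurable fun y => starRingEnd ℂ (k x y * m y) :=
    Complex.continuous_conj.measurable.comp ((hk.measurable x).mul hm)
  have hbound (x y : E3) : ‖starRingEnd ℂ (k x y * m y)‖ ≤ κ * a := by
    rw [RCLike.norm_conj, norm_mul]
    exact mul_le_mul (hk.norm_le x y) (ha y) (norm_nonneg _) hκ
  have hsupport (x : E3) : Function.support (fun y => starRingEnd ℂ (k x y * m y)) ⊆ E :=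
    fun y hy => hsupp fun hmy => hy (by simp [hmy])
  have hL2 (x : E3) : MemLp (fun y => starRingEnd ℂ (k x y * m y)) 2 volume :=
    memLp_two_of_support_subset (hmeas x) hE (hbound x) (hsupport x)
  refine ⟨fun x => (hL2 x).toLp _, fun f => ?_, fun x => norm_toLp_le_of_support_subset (hL2 x) hE
    (mul_nonneg hκ ha₀) (hbound x) (hsupport x)⟩
  have hmf : Integrable (mulCLM m hm hb f) volume :=
    ((memLp_two_of_support_subset hm hE ha hsupp).integrable_mul (Lp.memLp f)).congr
      (mulCLM_ae m hm hb f).symm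
  filter_upwards [hk.apply_ae _ hmf] with x hx
  rw [ContinuousLinearMap.comp_apply, hx, L2.inner_def]
  refine integral_congr_ae ?_
  filter_upwards [mulCLM_ae m hm hb f, (hL2 x).coeFn_toLp] with y hy hy'
  rw [hy, hy', RCLike.inner_apply, Complex.conj_conj]
  ring

end BoundedKernel

section DyadicShells

theorem one_le_bracket (x : E3) : 1 ≤ bracket x :=
  Real.one_le_sqrt.2 (le_add_of_nonneg_right (sq_nonneg _))

theorem bracket_pos (x : E3) : 0 < bracket x := zero_lt_one.trans_le (one_le_bracket x)

theorem norm_lt_bracket (x : E3) : ‖x‖ < bracket x := Real.lt_sqrt_of_sq_lt (lt_one_add _)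

theorem measurable_bracket_smul (lam : ℝ) : Measurable fun y : E3 => bracket (lam • y) := by
  unfold bracket
  fun_prop

/-- The inverse weight `⟨λy⟩^{-σ}`. -/
def invWeight (lam σ : ℝ) (y : E3) : ℂ := ((bracket (lam • y) ^ (-σ) : ℝ) : ℂ)

theorem measurable_invWeight (lam σ : ℝ) : Measurable (invWeight lam σ) :=
  Complex.measurable_ofReal.comp ((measurable_bracket_smul lam).pow_const _)

theorem norm_invWeight (lam σ : ℝ) (y : E3) : ‖invWeight lam σ y‖ = bracket (lam • y) ^ (-σ) := by
  rw [invWeight, Complex.norm_real, Real.norm_of_nonneg (Real.rpow_nonneg (bracket_pos _).le _)]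

theorem norm_invWeight_le_one (lam : ℝ) {σ : ℝ} (hσ : 0 ≤ σ) (y : E3) :
    ‖invWeight lam σ y‖ ≤ 1 := by
  rw [norm_invWeight]
  exact Real.rpow_le_one_of_one_le_of_nonpos (one_le_bracket _) (neg_nonpos.2 hσ)

/-- The dyadic shell `2^k ≤ ⟨λy⟩ < 2^{k+1}`. -/
def shell (lam : ℝ) (k : ℕ) : Set E3 :=
  (fun y => bracket (lam • y)) ⁻¹' Set.Ico (2 ^ k) (2 ^ (k + 1))

theorem measurableSet_shell (lam : ℝ) (k : ℕ) : MeasurableSet (shell lam k) :=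
  measurable_bracket_smul lam measurableSet_Ico

theorem existsUnique_mem_shell (lam : ℝ) (y : E3) : ∃! k, y ∈ shell lam k := by
  obtain ⟨k, hk, hk'⟩ := exists_nat_pow_near (one_le_bracket (lam • y)) (one_lt_two (α := ℝ))
  refine ⟨k, ⟨hk, hk'⟩, fun j hj => ?_⟩
  have hjk : j < k + 1 := (pow_lt_pow_iff_right₀ (one_lt_two (α := ℝ))).1 (hj.1.trans_lt hk')
  have hkj : k < j + 1 := (pow_lt_pow_iff_right₀ (one_lt_two (α := ℝ))).1 (hk.trans_lt hj.2)
  omega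

theorem volume_shell_le {lam : ℝ} (hlam : 0 < lam) (k : ℕ) :
    volume (shell lam k) ≤ ENNReal.ofReal ((2 ^ (k + 1) / lam) ^ 3 * (4 / 3 * Real.pi)) := by
  have hsub : shell lam k ⊆ Metric.ball 0 (2 ^ (k + 1) / lam) := fun y hy => by
    have hlt := (norm_lt_bracket (lam • y)).trans hy.2
    rw [norm_smul, Real.norm_of_nonneg hlam.le] at hlt
    rwa [mem_ball_zero_iff, lt_div_iff₀' hlam]
  refine (measure_mono hsub).trans_eq ?_
  rw [EuclideanSpace.volume_ball_fin_three, ← ENNReal.ofReal_pow (by positivity),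
    ← ENNReal.ofReal_mul (by positivity)]
  ring_nf

/-- The part of the inverse weight `⟨λy⟩^{-σ}` on a dyadic shell. -/
def shellWeight (lam σ : ℝ) (k : ℕ) : E3 → ℂ := (shell lam k).indicator (invWeight lam σ)

theorem measurable_shellWeight (lam σ : ℝ) (k : ℕ) : Measurable (shellWeight lam σ k) :=
  (measurable_invWeight lam σ).indicator (measurableSet_shell lam k)

theorem norm_shellWeight_le_one (lam : ℝ) {σ : ℝ} (hσ : 0 ≤ σ) (k : ℕ) (y : E3) :
    ‖shellWeight lam σ k y‖ ≤ 1 :=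
  (norm_indicator_le_norm_self _ _).trans (norm_invWeight_le_one lam hσ y)

theorem norm_shellWeight_le (lam : ℝ) {σ : ℝ} (hσ : 0 ≤ σ) (k : ℕ) (y : E3) :
    ‖shellWeight lam σ k y‖ ≤ ((2 : ℝ) ^ (-σ)) ^ k := by
  unfold shellWeight
  by_cases hy : y ∈ shell lam k
  · rw [Set.indicator_of_mem hy, norm_invWeight, Real.rpow_pow_comm two_pos.le]
    exact Real.rpow_le_rpow_of_nonpos (by positivity) hy.1 (neg_nonpos.2 hσ)
  · rw [Set.indicator_of_notMem hy, norm_zero]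
    positivity

theorem hasSum_shellWeight (lam σ : ℝ) (y : E3) :
    HasSum (fun k => shellWeight lam σ k y) (invWeight lam σ y) := by
  obtain ⟨k, hk, huniq⟩ := existsUnique_mem_shell lam y
  rw [← Set.indicator_of_mem hk (invWeight lam σ)]
  exact hasSum_single k fun j hj => Set.indicator_of_notMem (fun hy => hj (huniq j hy)) _

/-- Multiplication by `⟨λy⟩^{-σ}`. -/
def invWeightCLM (lam : ℝ) {σ : ℝ} (hσ : 0 ≤ σ) : L2 →L[ℂ] L2 :=
  mulCLM _ (measurable_invWeight lam σ) (norm_invWeight_le_one lam hσ)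

/-- Multiplication by the part of `⟨λy⟩^{-σ}` on a dyadic shell. -/
def shellCLM (lam : ℝ) {σ : ℝ} (hσ : 0 ≤ σ) (k : ℕ) : L2 →L[ℂ] L2 :=
  mulCLM _ (measurable_shellWeight lam σ k) (norm_shellWeight_le_one lam hσ k)

theorem norm_shellCLM_le (lam : ℝ) {σ : ℝ} (hσ : 0 ≤ σ) (k : ℕ) :
    ‖shellCLM lam hσ k‖ ≤ ((2 : ℝ) ^ (-σ)) ^ k :=
  norm_mulCLM_le _ _ (by positivity) (norm_shellWeight_le lam hσ k)

theorem tsum_enorm_ne_top_of_le_geometric {E : Type*} [SeminormedAddCommGroup E] {v : ℕ → E}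
    {q C : ℝ} (hq₀ : 0 ≤ q) (hq₁ : q < 1) (hv : ∀ k, ‖v k‖ ≤ q ^ k * C) : ∑' k, ‖v k‖ₑ ≠ ∞ :=
  tsum_enorm_ne_top_iff_summable_norm.2 <| .of_nonneg_of_le (fun _ => norm_nonneg _) hv
    ((summable_geometric_of_lt_one hq₀ hq₁).mul_right C)

theorem tsum_enorm_comp_shellCLM_ne_top (V : L2 →L[ℂ] L2) (lam : ℝ) {σ : ℝ} (hσ : 0 < σ)
    (f : L2) : ∑' k, ‖V (shellCLM lam hσ.le k f)‖ₑ ≠ ∞ := by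
  refine tsum_enorm_ne_top_of_le_geometric (q := 2 ^ (-σ)) (C := ‖V‖ * ‖f‖) (by positivity)
    (Real.rpow_lt_one_of_one_lt_of_neg one_lt_two (neg_lt_zero.2 hσ)) fun k => ?_
  refine (V.le_opNorm_of_le ((shellCLM lam hσ.le k).le_of_opNorm_le
    (norm_shellCLM_le lam hσ.le k) f)).trans_eq (by ring)

theorem invWeightCLM_apply_eq_tsum (lam : ℝ) {σ : ℝ} (hσ : 0 < σ) (f : L2) :
    invWeightCLM lam hσ.le f = ∑' k, shellCLM lam hσ.le k f := by
  refine Lp.ext ?_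
  filter_upwards [Lp.hasSum_coeFn_tsum (tsum_enorm_comp_shellCLM_ne_top (.id ℂ L2) lam hσ f),
    ae_all_iff.2 fun k => mulCLM_ae _ (measurable_shellWeight lam σ k)
      (norm_shellWeight_le_one lam hσ.le k) f,
    mulCLM_ae _ (measurable_invWeight lam σ) (norm_invWeight_le_one lam hσ.le) f]
    with x hsum hshell hweight
  refine (((hasSum_shellWeight lam σ x).mul_right (f x)).unique ?_ ▸ hweight :)
  simpa only [shellCLM, ContinuousLinearMap.id_apply, hshell] using hsum

theorem enorm_comp_invWeightCLM_le (V : L2 →L[ℂ] L2) (lam : ℝ) {σ : ℝ} (hσ : 0 < σ) (f : L2) :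
    ∀ᵐ x, ‖(V ∘L invWeightCLM lam hσ.le) f x‖ₑ ≤
      ∑' k, ‖(V ∘L shellCLM lam hσ.le k) f x‖ₑ := by
  have hsummable : Summable fun k => shellCLM lam hσ.le k f :=
    .of_enorm (tsum_enorm_comp_shellCLM_ne_top (.id ℂ L2) lam hσ f)
  filter_upwards [Lp.coeFn_tsum (tsum_enorm_comp_shellCLM_ne_top V lam hσ f)] with x hx
  rw [ContinuousLinearMap.comp_apply, invWeightCLM_apply_eq_tsum lam hσ f,
    V.map_tsum hsummable, hx]
  exact enorm_tsum_le_tsum_enorm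

end DyadicShells

section WeightedBound

/-- The square root of the rate at which the contributions of the dyadic shells decay. -/
def shellRate (σ α : ℝ) : ℝ := 2 ^ (3 / 2 * α - σ)

theorem shellRate_pos (σ α : ℝ) : 0 < shellRate σ α := Real.rpow_pos_of_pos two_pos _

theorem shellRate_lt_one {σ α : ℝ} (hσ : 3 / 2 * α < σ) : shellRate σ α < 1 :=
  Real.rpow_lt_one_of_one_lt_of_neg one_lt_two (sub_neg.2 hσ)

/-- The constant of the weighted density bound; `32π/3` is the volume of a ball of radius `2`. -/
def weightConst (σ α : ℝ) : ℝ := (32 / 3 * Real.pi) ^ α * (1 - shellRate σ α)⁻¹ ^ 2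

theorem weightConst_pos {σ α : ℝ} (hσ : 3 / 2 * α < σ) : 0 < weightConst σ α := by
  have hgap : 0 < 1 - shellRate σ α := sub_pos.2 (shellRate_lt_one hσ)
  unfold weightConst
  positivity

theorem one_le_weightConst_zero {σ : ℝ} (hσ : 0 < σ) : 1 ≤ weightConst σ 0 := by
  have hgap : 0 < 1 - shellRate σ 0 := sub_pos.2 (shellRate_lt_one (by simpa using hσ))
  rw [weightConst, Real.rpow_zero, one_mul]
  exact one_le_pow₀ ((one_le_inv₀ hgap).2 (sub_le_self _ (shellRate_pos σ 0).le))

theorem shellRate_sq (σ α : ℝ) : shellRate σ α ^ 2 = (2 ^ (-σ)) ^ 2 * 8 ^ α := by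
  rw [shellRate, show (8 : ℝ) = 2 ^ (3 : ℝ) by norm_num, ← Real.rpow_mul two_pos.le,
    ← Real.rpow_mul_natCast two_pos.le, ← Real.rpow_mul_natCast two_pos.le,
    ← Real.rpow_add two_pos]
  congr 1
  push_cast
  ring

theorem geometric_rpow_mul_rpow_one_sub {a b c : ℝ} (ha : 0 < a) (hb : 0 ≤ b) (hc : 0 ≤ c)
    (α : ℝ) (n : ℕ) : (a ^ n * b ^ n * c) ^ α * (a ^ n) ^ (1 - α) = (a * b ^ α) ^ n * c ^ α := by
  have hexp : (a ^ n) ^ α * (a ^ n) ^ (1 - α) = a ^ n := by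
    rw [← Real.rpow_add (by positivity), add_sub_cancel, Real.rpow_one]
  rw [Real.mul_rpow (by positivity) hc, Real.mul_rpow (by positivity) (by positivity), mul_pow,
    Real.rpow_pow_comm hb]
  linear_combination (b ^ n) ^ α * c ^ α * hexp

theorem eLpNorm_localDensity_shell_le {r r' : ℝ≥0∞} [hrr : ENNReal.HolderConjugate r r']
    {V G : L2 →L[ℂ] L2} {k : E3 → E3 → ℂ} {κ lam σ : ℝ} (hV : ‖V‖ ≤ 1) (hG : ‖G‖ ≤ 1)
    (hk : IsBoundedKernel V k κ) (hlam : 0 < lam) (hσ : 0 ≤ σ) (B : L2 →L[ℂ] L2) (n : ℕ) :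
    eLpNorm (localDensity ((V ∘L shellCLM lam hσ n) ∘L G ∘L absRoot 1 B)) r volume ≤
      ENNReal.ofReal ((shellRate σ (r'⁻¹).toReal ^ 2) ^ n) *
        (ENNReal.ofReal ((32 / 3 * Real.pi * (κ ^ 2 / lam ^ 3)) ^ (r'⁻¹).toReal) *
          schattenNorm r B) := by
  have hvol := volume_shell_le hlam n
  set v : ℝ := (2 ^ (n + 1) / lam) ^ 3 * (4 / 3 * Real.pi) with hv
  obtain ⟨a, ha⟩ : ∃ a, a = (2 : ℝ) ^ (-σ) := ⟨_, rfl⟩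
  have ha₀ : 0 < a := ha ▸ Real.rpow_pos_of_pos two_pos _
  obtain ⟨K, hK, hKM⟩ := hk.exists_isCarlemanKernel (measurable_shellWeight lam σ n)
    (norm_shellWeight_le_one lam hσ n) (hvol.trans_lt ENNReal.ofReal_lt_top).ne
    (ha ▸ norm_shellWeight_le lam hσ n) Set.support_indicator_subset
  have hκ : 0 ≤ κ := (norm_nonneg _).trans (hk.norm_le 0 0)
  have hnorm : ‖(V ∘L shellCLM lam hσ n) ∘L G‖ ≤ a ^ n :=
    calc ‖(V ∘L shellCLM lam hσ n) ∘L G‖ ≤ ‖V‖ * ‖shellCLM lam hσ n‖ * ‖G‖ :=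
          (ContinuousLinearMap.opNorm_comp_le _ _).trans
            (by gcongr; exact ContinuousLinearMap.opNorm_comp_le _ _)
      _ ≤ 1 * a ^ n * 1 := by gcongr; exact ha ▸ norm_shellCLM_le lam hσ n
      _ = a ^ n := by ring
  have hkernel (x : E3) : ‖adjoint G (K x)‖ ≤ √v * (κ * a ^ n) := by
    refine (adjoint G).le_of_opNorm_le_of_le (by rwa [LinearIsometryEquiv.norm_map])
      ((hKM x).trans ?_) |>.trans_eq (one_mul _)
    gcongr
    exact ENNReal.toReal_le_of_le_ofReal (by positivity) hvol
  have hsq : (√v * (κ * a ^ n)) ^ 2 =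
      (a ^ 2) ^ n * 8 ^ n * (32 / 3 * Real.pi * (κ ^ 2 / lam ^ 3)) := by
    rw [mul_pow, Real.sq_sqrt (by positivity), hv, show (8 : ℝ) = 2 ^ 3 by norm_num,
      pow_right_comm a, pow_right_comm (2 : ℝ)]
    ring
  rw [← ContinuousLinearMap.comp_assoc, shellRate_sq, ← ha, ← mul_assoc,
    ← ENNReal.ofReal_mul (by positivity),
    ← geometric_rpow_mul_rpow_one_sub (by positivity) (by norm_num) (by positivity), ← hsq,
    pow_right_comm a, ← toReal_inv_eq_one_sub r r']
  exact eLpNorm_localDensity_absRoot_le hnorm (hK.comp G) hkernel B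

theorem eLpNorm_localDensity_invWeight_le {r r' : ℝ≥0∞} [hrr : ENNReal.HolderConjugate r r']
    {V G : L2 →L[ℂ] L2} {k : E3 → E3 → ℂ} {κ lam σ : ℝ} (hV : ‖V‖ ≤ 1) (hG : ‖G‖ ≤ 1)
    (hk : IsBoundedKernel V k κ) (hlam : 0 < lam) (hσ₀ : 0 < σ)
    (hσ : 3 / 2 * (r'⁻¹).toReal < σ) (B : L2 →L[ℂ] L2) :
    eLpNorm (localDensity ((V ∘L invWeightCLM lam hσ₀.le) ∘L G ∘L absRoot 1 B)) r volume ≤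
      ENNReal.ofReal (weightConst σ (r'⁻¹).toReal * (κ ^ 2 / lam ^ 3) ^ (r'⁻¹).toReal) *
        schattenNorm r B := by
  have hpoint (f : L2) : ∀ᵐ x, ‖((V ∘L invWeightCLM lam hσ₀.le) ∘L G ∘L absRoot 1 B) f x‖ₑ ≤
      ∑' n, ‖((V ∘L shellCLM lam hσ₀.le n) ∘L G ∘L absRoot 1 B) f x‖ₑ :=
    enorm_comp_invWeightCLM_le V lam hσ₀ (G (absRoot 1 B f))
  have hshell := eLpNorm_localDensity_shell_le (r := r) (r' := r') hV hG hk hlam hσ₀.le B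
  refine (eLpNorm_localDensity_le_of_geometric hpoint (shellRate_pos σ _) (shellRate_lt_one hσ)
    hrr.one_le hshell).trans_eq ?_
  rw [← mul_assoc, ← ENNReal.ofReal_mul (by positivity),
    Real.mul_rpow (by positivity) (by positivity), weightConst]
  congr 2
  ring

end WeightedBound

section DensityBound

theorem setLIntegral_lt_top_of_eLpNorm_lt_top {α : Type*} [MeasurableSpace α] {μ : Measure α}
    {n : α → ℝ≥0∞} (hn : Measurable n) {r : ℝ≥0∞} (hr : 1 ≤ r) (h : eLpNorm n r μ < ∞)
    {S : Set α} (hS : μ S < ∞) : ∫⁻ x in S, n x ∂μ < ∞ := by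
  have : IsFiniteMeasure (μ.restrict S) := ⟨by simpa using hS⟩
  have hmem : MemLp n r (μ.restrict S) := MemLp.restrict S ⟨hn.aestronglyMeasurable, h⟩
  simpa [eLpNorm_one_eq_lintegral_enorm] using (hmem.mono_exponent hr).2

theorem eLpNorm_pairDensity_le {H : Type*} [NormedAddCommGroup H] [InnerProductSpace ℂ H]
    [CompleteSpace H] [TopologicalSpace.SeparableSpace H] {α : Type*} [MeasurableSpace α]
    {μ : Measure α} (X Y : H →L[ℂ] Lp ℂ 2 μ) {r : ℝ≥0∞} (hr : 1 ≤ r) :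
    eLpNorm (pairDensity X Y) r μ ≤
      eLpNorm (localDensity X) r μ + eLpNorm (localDensity Y) r μ :=
  (eLpNorm_mono_enorm (g := localDensity X + localDensity Y) (enorm_pairDensity_le X Y)).trans <|
    eLpNorm_add_le (measurable_localDensity X).aestronglyMeasurable
      (measurable_localDensity Y).aestronglyMeasurable hr

theorem isDensity_comp_adjoint (ħ : ℝ) {X Y : L2 →L[ℂ] L2} {r : ℝ≥0∞} (hr : 1 ≤ r)
    (hX : eLpNorm (localDensity X) r volume < ∞) (hY : eLpNorm (localDensity Y) r volume < ∞) :
    IsDensity ħ (X ∘L adjoint Y)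
      (fun x => (((2 * Real.pi * ħ) ^ 3 : ℝ) : ℂ) * pairDensity X Y x) :=
  isDensity_pairDensity ħ
    (fun _ hS => setLIntegral_lt_top_of_eLpNorm_lt_top (measurable_localDensity X) hr hX
      hS.measure_lt_top)
    (fun _ hS => setLIntegral_lt_top_of_eLpNorm_lt_top (measurable_localDensity Y) hr hY
      hS.measure_lt_top)

theorem eLpNorm_ofReal_mul {α : Type*} [MeasurableSpace α] {c : ℝ} (hc : 0 ≤ c) (f : α → ℂ)
    (r : ℝ≥0∞) (μ : Measure α) :
    eLpNorm (fun x => (c : ℂ) * f x) r μ = ENNReal.ofReal c * eLpNorm f r μ := by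
  have hc_enorm : ‖(c : ℂ)‖ₑ = ENNReal.ofReal c := by
    rw [← ofReal_norm, Complex.norm_of_nonneg hc]
  rw [← hc_enorm]
  exact eLpNorm_const_smul (c : ℂ) f r μ

/-- The operator `A` obeys the density bound with constant `C` and right-hand side `N`: if `N` is
finite, then the density of `A` exists, and its `L^r` norm is at most `C N`. -/
def HasDensityBound (ħ : ℝ) (A : L2 →L[ℂ] L2) (r : ℝ≥0∞) (C : ℝ) (N : ℝ≥0∞) : Prop :=
  (N < ∞ → ∃ ρ, IsDensity ħ A ρ) ∧
    ∀ ρ, IsDensity ħ A ρ → eLpNorm ρ r volume ≤ ENNReal.ofReal C * N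

theorem hasDensityBound_comp_adjoint {ħ : ℝ} (hħ : 0 < ħ) {X Y : L2 →L[ℂ] L2} {r N : ℝ≥0∞}
    (hr : 1 ≤ r) {C : ℝ} (hC : 0 < C)
    (hX : eLpNorm (localDensity X) r volume ≤ ENNReal.ofReal C * N)
    (hY : eLpNorm (localDensity Y) r volume ≤ ENNReal.ofReal C * N) :
    HasDensityBound ħ (X ∘L adjoint Y) r ((2 * Real.pi * ħ) ^ 3 * (2 * C)) N := by
  have hden (hN : N < ∞) : IsDensity ħ (X ∘L adjoint Y)
      (fun x => (((2 * Real.pi * ħ) ^ 3 : ℝ) : ℂ) * pairDensity X Y x) :=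
    have hCN := ENNReal.mul_lt_top ENNReal.ofReal_lt_top hN
    isDensity_comp_adjoint ħ hr (hX.trans_lt hCN) (hY.trans_lt hCN)
  refine ⟨fun hN => ⟨_, hden hN⟩, fun ρ hρ => ?_⟩
  rcases eq_or_ne N ∞ with rfl | hN
  · rw [ENNReal.mul_top (ENNReal.ofReal_pos.2 (by positivity)).ne']
    exact le_top
  rw [eLpNorm_congr_ae (hρ.ae_eq (hden hN.lt_top))]
  calc eLpNorm (fun x => (((2 * Real.pi * ħ) ^ 3 : ℝ) : ℂ) * pairDensity X Y x) r volume
      = ENNReal.ofReal ((2 * Real.pi * ħ) ^ 3) * eLpNorm (pairDensity X Y) r volume := by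
        exact eLpNorm_ofReal_mul (by positivity) (pairDensity X Y) r volume
    _ ≤ ENNReal.ofReal ((2 * Real.pi * ħ) ^ 3) *
          (ENNReal.ofReal C * N + ENNReal.ofReal C * N) := by
        gcongr
        exact (eLpNorm_pairDensity_le X Y hr).trans (add_le_add hX hY)
    _ = ENNReal.ofReal ((2 * Real.pi * ħ) ^ 3 * (2 * C)) * N := by
        rw [ENNReal.ofReal_mul (by positivity), ENNReal.ofReal_mul two_pos.le]
        simp only [ENNReal.ofReal_ofNat]
        ring

theorem hasDensityBound_conj_adjoint {ħ : ℝ} (hħ : 0 < ħ) {S B : L2 →L[ℂ] L2} {r N : ℝ≥0∞}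
    (hr : 1 ≤ r) {C : ℝ} (hC : 0 < C)
    (h : ∀ U : L2 →L[ℂ] L2, ‖U‖ ≤ 1 →
      eLpNorm (localDensity (S ∘L U ∘L absRoot 1 B)) r volume ≤ ENNReal.ofReal C * N) :
    HasDensityBound ħ (S ∘L B ∘L adjoint S) r ((2 * Real.pi * ħ) ^ 3 * (2 * C)) N := by
  obtain ⟨U, hU, hUB⟩ := exists_contraction_comp_abs_eq B
  have hfactor : S ∘L B ∘L adjoint S =
      (S ∘L U ∘L absRoot 1 B) ∘L adjoint (S ∘L .id ℂ L2 ∘L absRoot 1 B) := by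
    conv_lhs => rw [← hUB, ← absRoot_one_comp_self]
    simp only [ContinuousLinearMap.id_comp, ContinuousLinearMap.adjoint_comp, adjoint_absRoot,
      ContinuousLinearMap.comp_assoc]
  rw [hfactor]
  exact hasDensityBound_comp_adjoint hħ hr hC (h U hU) (h _ ContinuousLinearMap.norm_id_le)

theorem HasDensityBound.congr_right {ħ : ℝ} {A : L2 →L[ℂ] L2} {r N N' : ℝ≥0∞} {C C' : ℝ}
    (h : HasDensityBound ħ A r C N) (hN : N' < ∞ → N < ∞)
    (hC : ENNReal.ofReal C * N ≤ ENNReal.ofReal C' * N') : HasDensityBound ħ A r C' N' :=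
  ⟨fun hN' => h.1 (hN hN'), fun ρ hρ => (h.2 ρ hρ).trans hC⟩

end DensityBound

section Fourier

variable {V : Type*} [NormedAddCommGroup V] [InnerProductSpace ℝ V] [FiniteDimensional ℝ V]
  [MeasurableSpace V] [BorelSpace V]

theorem continuous_fourier_of_integrable {f : V → ℂ} (hf : Integrable f) : Continuous (𝓕 f) :=
  VectorFourier.fourierIntegral_continuous Real.continuous_fourierChar continuous_inner hf

theorem continuous_fourierInv_of_integrable {f : V → ℂ} (hf : Integrable f) :
    Continuous (𝓕⁻ f) :=
  ((continuous_fourier_of_integrable hf).comp continuous_neg).congr fun x =>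
    (Real.fourierInv_eq_fourier_neg f x).symm

theorem integral_fourier_mul_eq {f g : V → ℂ} (hf : Integrable f) (hg : Integrable g) :
    ∫ x, 𝓕 f x * g x = ∫ x, f x * 𝓕 g x := by
  have h := VectorFourier.integral_fourierIntegral_smul_eq_flip (L := innerₗ V)
    Real.continuous_fourierChar continuous_inner hf hg
  rwa [flip_innerₗ] at h

theorem integral_fourierInv_mul_eq {f g : V → ℂ} (hf : Integrable f) (hg : Integrable g) :
    ∫ x, 𝓕⁻ f x * g x = ∫ x, f x * 𝓕⁻ g x := by
  have hsymm : (-innerₗ V).flip = -innerₗ V := by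
    ext x y
    simp [real_inner_comm]
  have h := VectorFourier.integral_fourierIntegral_smul_eq_flip (L := -innerₗ V)
    Real.continuous_fourierChar continuous_inner.neg hf hg
  rwa [hsymm] at h

theorem ae_eq_of_forall_integral_schwartzMap_mul_eq {f g : V → ℂ} (hf : LocallyIntegrable f)
    (hg : LocallyIntegrable g)
    (h : ∀ φ : SchwartzMap V ℂ, ∫ x, φ x * f x = ∫ x, φ x * g x) : f =ᵐ[volume] g := by
  refine ae_eq_of_integral_contDiff_smul_eq hf hg fun φ hφ hφ_supp => ?_
  have hsupp : HasCompactSupport (Complex.ofRealCLM ∘ φ) := hφ_supp.comp_left rfl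
  simpa using h (hsupp.toSchwartzMap (Complex.ofRealCLM.contDiff.comp hφ))

theorem locallyIntegrable_coe_Lp (f : Lp ℂ 2 (volume : Measure V)) :
    LocallyIntegrable f :=
  (Lp.memLp f).locallyIntegrable one_le_two

theorem coeFn_Lp_fourier_ae_eq (f : Lp ℂ 2 (volume : Measure V)) (hf : Integrable f) :
    (𝓕 f : Lp ℂ 2 (volume : Measure V)) =ᵐ[volume] 𝓕 (f : V → ℂ) := by
  refine ae_eq_of_forall_integral_schwartzMap_mul_eq (locallyIntegrable_coe_Lp _)
    (continuous_fourier_of_integrable hf).locallyIntegrable fun φ => ?_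
  have h := congrArg (fun T => T φ) (Lp.fourier_toTemperedDistribution_eq f)
  simp only [TemperedDistribution.fourier_apply, Lp.toTemperedDistribution_apply, smul_eq_mul,
    SchwartzMap.fourier_coe] at h
  rw [← h, integral_fourier_mul_eq φ.integrable hf]

theorem coeFn_Lp_fourierInv_ae_eq (f : Lp ℂ 2 (volume : Measure V)) (hf : Integrable f) :
    (𝓕⁻ f : Lp ℂ 2 (volume : Measure V)) =ᵐ[volume] 𝓕⁻ (f : V → ℂ) := by
  refine ae_eq_of_forall_integral_schwartzMap_mul_eq (locallyIntegrable_coe_Lp _)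
    (continuous_fourierInv_of_integrable hf).locallyIntegrable fun φ => ?_
  have h := congrArg (fun T => T φ) (Lp.fourierInv_toTemperedDistribution_eq f)
  simp only [TemperedDistribution.fourierInv_apply, Lp.toTemperedDistribution_apply, smul_eq_mul,
    SchwartzMap.fourierInv_coe] at h
  rw [← h, integral_fourierInv_mul_eq φ.integrable hf]

theorem isBoundedKernel_fourierL2_symm :
    IsBoundedKernel (fourierL2.symm.toContinuousLinearEquiv : L2 →L[ℂ] L2)
      (fun x y => Complex.exp (((2 * Real.pi * ⟪y, x⟫_ℝ : ℝ) : ℂ) * Complex.I)) 1 where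
  measurable x := by fun_prop
  norm_le x y := (Complex.norm_exp_ofReal_mul_I _).le
  apply_ae g hg := by
    filter_upwards [coeFn_Lp_fourierInv_ae_eq g hg] with x hx
    exact hx.trans (Real.fourierInv_eq' _ _)

end Fourier

section StrongLimits

theorem tendsto_Lp_two_of_dominated {α : Type*} [MeasurableSpace α] {μ : Measure α}
    {f : ℕ → Lp ℂ 2 μ} {f' : Lp ℂ 2 μ} {g : α → ℝ} (hg : MemLp g 2 μ)
    (hdom : ∀ n, ∀ᵐ x ∂μ, ‖f n x - f' x‖ ≤ g x)
    (hlim : ∀ᵐ x ∂μ, Filter.Tendsto (fun n => f n x) Filter.atTop (nhds (f' x))) :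
    Filter.Tendsto f Filter.atTop (nhds f') := by
  have hsq (n : ℕ) : edist (f n) f' ^ 2 = ∫⁻ x, ‖f n x - f' x‖ₑ ^ 2 ∂μ := by
    rw [edist_eq_enorm_sub, enorm_sq_eq_lintegral]
    refine lintegral_congr_ae ?_
    filter_upwards [Lp.coeFn_sub (f n) f'] with x hx
    rw [hx, Pi.sub_apply]
  have hint : Filter.Tendsto (fun n => ∫⁻ x, ‖f n x - f' x‖ₑ ^ 2 ∂μ) Filter.atTop
      (nhds (∫⁻ _, 0 ∂μ)) := by
    refine tendsto_lintegral_of_dominated_convergence (fun x => ‖g x‖ₑ ^ 2)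
      (fun n => ((measurable_coe_Lp _).sub (measurable_coe_Lp _)).enorm.pow_const 2)
      (fun n => ?_) ?_ ?_
    · filter_upwards [hdom n] with x hx
      gcongr
      exact enorm_le_iff_norm_le.2 (hx.trans (le_abs_self _))
    · simpa using (lintegral_rpow_enorm_lt_top_of_eLpNorm_lt_top two_ne_zero
        ENNReal.ofNat_ne_top hg.2).ne
    · filter_upwards [hlim] with x hx
      have h0 : Filter.Tendsto (fun n => f n x - f' x) Filter.atTop (nhds 0) := by
        simpa using hx.sub_const (f' x)
      simpa [Function.comp_def] using
        ((ENNReal.continuous_pow 2).comp continuous_enorm).tendsto (0 : ℂ) |>.comp h0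
  have hroot := (ENNReal.continuous_rpow_const (y := 2⁻¹)).tendsto _ |>.comp hint
  rw [lintegral_zero, ENNReal.zero_rpow_of_pos (by norm_num)] at hroot
  refine tendsto_iff_edist_tendsto_0.2 (hroot.congr fun n => ?_)
  rw [Function.comp_apply, ← hsq, ← ENNReal.rpow_natCast, ← ENNReal.rpow_mul]
  norm_num

theorem tendsto_mulCLM {m : ℕ → E3 → ℂ} {m' : E3 → ℂ} (hm : ∀ n, Measurable (m n))
    (hb : ∀ n x, ‖m n x‖ ≤ 1) (hm' : Measurable m') (hb' : ∀ x, ‖m' x‖ ≤ 1)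
    (h : ∀ x, Filter.Tendsto (fun n => m n x) Filter.atTop (nhds (m' x))) (f : L2) :
    Filter.Tendsto (fun n => mulCLM (m n) (hm n) (hb n) f) Filter.atTop
      (nhds (mulCLM m' hm' hb' f)) := by
  refine tendsto_Lp_two_of_dominated ((Lp.memLp f).norm.const_mul 2) (fun n => ?_) ?_
  · filter_upwards [mulCLM_ae (m n) (hm n) (hb n) f, mulCLM_ae m' hm' hb' f] with x hx hx'
    rw [hx, hx', ← sub_mul, norm_mul]
    gcongr
    linarith [norm_sub_le (m n x) (m' x), hb n x, hb' x]
  · filter_upwards [ae_all_iff.2 fun n => mulCLM_ae (m n) (hm n) (hb n) f,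
      mulCLM_ae m' hm' hb' f] with x hx hx'
    simp only [hx, hx']
    exact (h x).mul_const _

theorem IsBoundedKernel.mono {V : L2 →L[ℂ] L2} {k : E3 → E3 → ℂ} {κ κ' : ℝ}
    (hk : IsBoundedKernel V k κ) (h : κ ≤ κ') : IsBoundedKernel V k κ' :=
  ⟨hk.measurable, fun x y => (hk.norm_le x y).trans h, hk.apply_ae⟩

theorem IsBoundedKernel.of_tendsto {V : ℕ → L2 →L[ℂ] L2} {V' : L2 →L[ℂ] L2}
    {k : ℕ → E3 → E3 → ℂ} {k' : E3 → E3 → ℂ} {κ : ℝ} (hk : ∀ n, IsBoundedKernel (V n) (k n) κ)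
    (hV : ∀ g, Filter.Tendsto (fun n => V n g) Filter.atTop (nhds (V' g)))
    (hlim : ∀ x y, Filter.Tendsto (fun n => k n x y) Filter.atTop (nhds (k' x y))) :
    IsBoundedKernel V' k' κ where
  measurable x := measurable_of_tendsto_metrizable (fun n => (hk n).measurable x)
    (tendsto_pi_nhds.2 (hlim x))
  norm_le x y := le_of_tendsto (hlim x y).norm (.of_forall fun n => (hk n).norm_le x y)
  apply_ae g hg := by
    obtain ⟨φ, hφ, hconv⟩ := (tendstoInMeasure_of_tendsto_Lp (hV g)).exists_seq_tendsto_ae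
    filter_upwards [hconv, ae_all_iff.2 fun n => (hk n).apply_ae g hg] with x hx hkx
    have hint : Filter.Tendsto (fun n => ∫ y, k n x y * g y) Filter.atTop
        (nhds (∫ y, k' x y * g y)) := by
      refine tendsto_integral_of_dominated_convergence (fun y => κ * ‖g y‖)
        (fun n => ((hk n).measurable x).aestronglyMeasurable.mul hg.1) (hg.norm.const_mul κ)
        (fun n => .of_forall fun y => ?_) (.of_forall fun y => (hlim x y).mul_const (g y))
      rw [norm_mul]
      gcongr
      exact (hk n).norm_le x y
    refine tendsto_nhds_unique (hx.congr fun n => ?_) (hint.comp hφ.tendsto_atTop)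
    exact hkx (φ n)

end StrongLimits

section FreePropagator

/-- The bounded operator `𝓕⁻¹ A 𝓕`: if `A` is the multiplication by `m`, this is the Fourier
multiplier with symbol `m`. -/
def fourierConj (A : L2 →L[ℂ] L2) : L2 →L[ℂ] L2 :=
  (fourierL2.symm.toContinuousLinearEquiv : L2 →L[ℂ] L2) ∘L A ∘L
    (fourierL2.toContinuousLinearEquiv : L2 →L[ℂ] L2)

theorem fourierConj_apply (A : L2 →L[ℂ] L2) (f : L2) :
    fourierConj A f = fourierL2.symm (A (fourierL2 f)) := rfl

/-- The Gaussian symbol `e^{-b|ξ|²}`, with a complex parameter `b`. -/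
def gaussSymbol (b : ℂ) (ξ : E3) : ℂ := Complex.exp (-b * ‖ξ‖ ^ 2)

theorem measurable_gaussSymbol (b : ℂ) : Measurable (gaussSymbol b) := by
  unfold gaussSymbol
  fun_prop

theorem norm_gaussSymbol_le_one {b : ℂ} (hb : 0 ≤ b.re) (ξ : E3) : ‖gaussSymbol b ξ‖ ≤ 1 := by
  have hre : (-b * ‖ξ‖ ^ 2 : ℂ).re = -(b.re * ‖ξ‖ ^ 2) := by
    rw [← Complex.ofReal_pow, Complex.re_mul_ofReal, Complex.neg_re, neg_mul]
  rw [gaussSymbol, Complex.norm_exp, Real.exp_le_one_iff, hre, neg_nonpos]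
  positivity

/-- The Fourier multiplier with symbol `e^{-b|ξ|²}`, that is `e^{bΔ/(4π²)}`. -/
def gaussMultiplier (b : ℂ) (hb : 0 ≤ b.re) : L2 →L[ℂ] L2 :=
  fourierConj (mulCLM _ (measurable_gaussSymbol b) (norm_gaussSymbol_le_one hb))

/-- The Gaussian convolution kernel `(π/b)^{3/2} e^{-π²|x-y|²/b}` of `e^{bΔ/(4π²)}`. -/
def gaussKernel (b : ℂ) (x y : E3) : ℂ :=
  (Real.pi / b) ^ (3 / 2 : ℂ) * Complex.exp (-Real.pi ^ 2 * ‖x - y‖ ^ 2 / b)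

theorem measurable_gaussKernel (b : ℂ) (x : E3) : Measurable (gaussKernel b x) := by
  unfold gaussKernel
  fun_prop

theorem norm_gaussKernel_le {b : ℂ} (hb : b ≠ 0) (hre : 0 ≤ b.re) (x y : E3) :
    ‖gaussKernel b x y‖ ≤ (Real.pi / ‖b‖) ^ (3 / 2 : ℝ) := by
  have hprefactor : ‖(Real.pi / b : ℂ) ^ (3 / 2 : ℂ)‖ = (Real.pi / ‖b‖) ^ (3 / 2 : ℝ) := by
    rw [show (3 / 2 : ℂ) = ((3 / 2 : ℝ) : ℂ) by norm_num, Complex.norm_cpow_of_ne_zero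
      (div_ne_zero (Complex.ofReal_ne_zero.2 Real.pi_ne_zero) hb)]
    simp [abs_of_pos Real.pi_pos]
  have hexp : ‖Complex.exp (-Real.pi ^ 2 * ‖x - y‖ ^ 2 / b)‖ ≤ 1 := by
    have hreal : (-Real.pi ^ 2 * ‖x - y‖ ^ 2 / b : ℂ) =
        ((-(Real.pi ^ 2 * ‖x - y‖ ^ 2) : ℝ) : ℂ) * b⁻¹ := by
      push_cast
      ring
    rw [Complex.norm_exp, Real.exp_le_one_iff, hreal, Complex.re_ofReal_mul, Complex.inv_re]
    exact mul_nonpos_of_nonpos_of_nonneg (neg_nonpos.2 (by positivity))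
      (div_nonneg hre (Complex.normSq_nonneg b))
  rw [gaussKernel, norm_mul, hprefactor]
  exact mul_le_of_le_one_right (by positivity) hexp

theorem integrable_gaussSymbol {b : ℂ} (hb : 0 < b.re) : Integrable (gaussSymbol b) := by
  refine (GaussianFourier.integrable_cexp_neg_mul_sq_norm_add hb 0 (0 : E3)).congr
    (.of_forall fun ξ => ?_)
  simp [gaussSymbol]

theorem fourierInv_gaussSymbol_mul_fourier {b : ℂ} (hb : 0 < b.re) {g : E3 → ℂ}
    (hg : Integrable g) (x : E3) :
    𝓕⁻ (fun ξ => gaussSymbol b ξ * 𝓕 g ξ) x = ∫ y, gaussKernel b x y * g y := by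
  have hgauss : Integrable fun ξ : E3 =>
      Complex.exp (-b * ‖ξ‖ ^ 2 + 2 * Real.pi * Complex.I * ⟪x, ξ⟫_ℝ) :=
    GaussianFourier.integrable_cexp_neg_mul_sq_norm_add hb (2 * Real.pi * Complex.I) x
  calc 𝓕⁻ (fun ξ => gaussSymbol b ξ * 𝓕 g ξ) x
      = ∫ ξ, Complex.exp (-b * ‖ξ‖ ^ 2 + 2 * Real.pi * Complex.I * ⟪x, ξ⟫_ℝ) * 𝓕 g ξ := by
        rw [Real.fourierInv_eq']
        refine integral_congr_ae (.of_forall fun ξ => ?_)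
        simp only [smul_eq_mul, gaussSymbol, ← mul_assoc, ← Complex.exp_add, real_inner_comm x ξ]
        congr 2
        push_cast
        ring
    _ = ∫ y, gaussKernel b x y * g y := by
        rw [← integral_fourier_mul_eq hgauss hg]
        refine integral_congr_ae (.of_forall fun y => ?_)
        simp only [fourier_gaussian_innerProductSpace' hb x y, gaussKernel, finrank_euclideanSpace,
          Fintype.card_fin, Nat.cast_ofNat]

theorem isBoundedKernel_gaussMultiplier_of_re_pos {b : ℂ} (hb : 0 < b.re) :
    IsBoundedKernel (gaussMultiplier b hb.le) (gaussKernel b) ((Real.pi / ‖b‖) ^ (3 / 2 : ℝ)) where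
  measurable := measurable_gaussKernel b
  norm_le := norm_gaussKernel_le (fun h => by simp [h] at hb) hb.le
  apply_ae g hg := by
    obtain ⟨h, hh⟩ : ∃ h, h = mulCLM _ (measurable_gaussSymbol b) (norm_gaussSymbol_le_one hb.le)
      (fourierL2 g) := ⟨_, rfl⟩
    have hae : h =ᵐ[volume] fun ξ => gaussSymbol b ξ * 𝓕 (g : E3 → ℂ) ξ := by
      filter_upwards [mulCLM_ae _ (measurable_gaussSymbol b) (norm_gaussSymbol_le_one hb.le)
        (fourierL2 g), coeFn_Lp_fourier_ae_eq g hg] with ξ hmul hfourier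
      rw [hh, hmul]
      exact congrArg _ hfourier
    have hint : Integrable h := by
      refine Integrable.congr ((integrable_gaussSymbol hb).mul_bdd (c := ∫ y, ‖g y‖)
        (continuous_fourier_of_integrable hg).aestronglyMeasurable
        (.of_forall fun ξ => ?_)) hae.symm
      exact VectorFourier.norm_fourierIntegral_le_integral_norm _ _ _ _ _
    filter_upwards [coeFn_Lp_fourierInv_ae_eq h hint] with x hx
    rw [gaussMultiplier, fourierConj_apply, ← hh, ← fourierInv_gaussSymbol_mul_fourier hb hg]
    exact hx.trans (Real.fourierInv_congr_ae hae x)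

theorem tendsto_gaussMultiplier {b : ℕ → ℂ} (hb : ∀ n, 0 ≤ (b n).re) {b' : ℂ} (hb' : 0 ≤ b'.re)
    (hlim : Filter.Tendsto b Filter.atTop (nhds b')) (g : L2) :
    Filter.Tendsto (fun n => gaussMultiplier (b n) (hb n) g) Filter.atTop
      (nhds (gaussMultiplier b' hb' g)) := by
  have hsymbol (ξ : E3) : Filter.Tendsto (fun n => gaussSymbol (b n) ξ) Filter.atTop
      (nhds (gaussSymbol b' ξ)) := by
    have hcont : Continuous fun c : ℂ => gaussSymbol c ξ := by
      unfold gaussSymbol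
      fun_prop
    exact (hcont.tendsto b').comp hlim
  exact (fourierL2.symm.continuous.tendsto _).comp (tendsto_mulCLM
    (fun n => measurable_gaussSymbol (b n)) (fun n => norm_gaussSymbol_le_one (hb n))
    (measurable_gaussSymbol b') (norm_gaussSymbol_le_one hb') hsymbol _)

theorem continuousAt_gaussKernel {b : ℂ} (hb : b ≠ 0) (hre : 0 ≤ b.re) (x y : E3) :
    ContinuousAt (fun c => gaussKernel c x y) b := by
  have hslit : (Real.pi / b : ℂ) ∈ Complex.slitPlane := by
    have hnorm : 0 < Complex.normSq b := Complex.normSq_pos.2 hb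
    rw [Complex.mem_slitPlane_iff, div_eq_mul_inv, Complex.re_ofReal_mul, Complex.im_ofReal_mul,
      Complex.inv_re, Complex.inv_im]
    rcases hre.lt_or_eq with hre | hre
    · exact .inl (by positivity)
    · have him : b.im ≠ 0 := fun him => hb (Complex.ext hre.symm him)
      exact .inr (by simp [him, hb, Real.pi_ne_zero])
  unfold gaussKernel
  exact ((continuousAt_const.div continuousAt_id hb).cpow continuousAt_const hslit).mul
    (Complex.continuous_exp.continuousAt.comp (continuousAt_const.div continuousAt_id hb))

theorem norm_le_norm_add_ofReal {b : ℂ} (hb : 0 ≤ b.re) {ε : ℝ} (hε : 0 ≤ ε) :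
    ‖b‖ ≤ ‖b + ε‖ := by
  rw [← sq_le_sq₀ (norm_nonneg _) (norm_nonneg _), Complex.sq_norm, Complex.sq_norm,
    Complex.normSq_apply, Complex.normSq_apply]
  simp only [Complex.add_re, Complex.ofReal_re, Complex.add_im, Complex.ofReal_im, add_zero]
  nlinarith [mul_nonneg hb hε]

theorem isBoundedKernel_gaussMultiplier {b : ℂ} (hb : b ≠ 0) (hre : 0 ≤ b.re) :
    IsBoundedKernel (gaussMultiplier b hre) (gaussKernel b) ((Real.pi / ‖b‖) ^ (3 / 2 : ℝ)) := by
  have hpos (n : ℕ) : 0 < (b + ((1 / ((n : ℝ) + 1) : ℝ) : ℂ)).re := by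
    rw [Complex.add_re, Complex.ofReal_re]
    positivity
  have hlim : Filter.Tendsto (fun n : ℕ => b + ((1 / ((n : ℝ) + 1) : ℝ) : ℂ)) Filter.atTop
      (nhds b) := by
    simpa using ((Complex.continuous_ofReal.tendsto 0).comp
      (tendsto_one_div_add_atTop_nhds_zero_nat (𝕜 := ℝ))).const_add b
  refine IsBoundedKernel.of_tendsto (fun n => ?_)
    (tendsto_gaussMultiplier (fun n => (hpos n).le) hre hlim)
    (fun x y => (continuousAt_gaussKernel hb hre x y).tendsto.comp hlim)
  refine (isBoundedKernel_gaussMultiplier_of_re_pos (hpos n)).mono ?_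
  have := norm_pos_iff.2 hb
  gcongr
  exact norm_le_norm_add_ofReal hre (by positivity)

theorem freeFlow_eq_gaussMultiplier (ħ t : ℝ) :
    freeFlow ħ t = gaussMultiplier (((2 * Real.pi ^ 2 * t * ħ : ℝ) : ℂ) * Complex.I)
      (Complex.re_ofReal_mul _ _ ▸ (mul_zero _).ge) := by
  have hsymbol : freeSymbol ħ t =
      gaussSymbol (((2 * Real.pi ^ 2 * t * ħ : ℝ) : ℂ) * Complex.I) := by
    funext ξ
    unfold freeSymbol gaussSymbol
    congr 1
    push_cast
    ring
  simp only [freeFlow, gaussMultiplier, fourierConj, hsymbol]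

theorem isBoundedKernel_freeFlow {ħ t : ℝ} (hħ : 0 < ħ) (ht : t ≠ 0) :
    IsBoundedKernel (freeFlow ħ t)
      (gaussKernel (((2 * Real.pi ^ 2 * t * ħ : ℝ) : ℂ) * Complex.I))
      ((2 * Real.pi * ħ * |t|)⁻¹ ^ (3 / 2 : ℝ)) := by
  have hscale : Real.pi / ‖((2 * Real.pi ^ 2 * t * ħ : ℝ) : ℂ) * Complex.I‖ =
      (2 * Real.pi * ħ * |t|)⁻¹ := by
    have := abs_pos.2 ht
    rw [norm_mul, Complex.norm_I, mul_one, Complex.norm_real, Real.norm_eq_abs]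
    simp only [abs_mul, abs_two, abs_pow, abs_of_pos Real.pi_pos, abs_of_pos hħ]
    field_simp
  rw [freeFlow_eq_gaussMultiplier, ← hscale]
  exact isBoundedKernel_gaussMultiplier
    (mul_ne_zero (Complex.ofReal_ne_zero.2 (by positivity)) Complex.I_ne_zero) _

end FreePropagator

section Sandwich

/-- The bounded operator `R` is a two-sided inverse of the unbounded operator `W`. -/
structure IsBoundedInverse {H : Type*} [NormedAddCommGroup H] [InnerProductSpace ℂ H]
    (W : H →ₗ.[ℂ] H) (R : H →L[ℂ] H) : Prop where
  right_inv : ∀ g, ∃ h : R g ∈ W.domain, W ⟨R g, h⟩ = g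
  left_inv : ∀ f : W.domain, R (W f) = f

theorem IsSandwich.eq_comp {H : Type*} [NormedAddCommGroup H] [InnerProductSpace ℂ H]
    {W : H →ₗ.[ℂ] H} {R A B : H →L[ℂ] H} (h : IsSandwich W A B) (hR : IsBoundedInverse W R) :
    A = R ∘L B ∘L R := by
  ext1 g
  obtain ⟨hg, hWg⟩ := hR.right_inv g
  obtain ⟨hAg, hB⟩ := h ⟨R g, hg⟩
  have hleft := hR.left_inv ⟨_, hAg⟩
  rw [hB] at hleft
  simp only [hWg] at hleft
  exact hleft.symm

theorem isBoundedInverse_mulOp {m n : E3 → ℂ} (hn : Measurable n) (hb : ∀ x, ‖n x‖ ≤ 1)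
    (hmn : ∀ x, m x * n x = 1) : IsBoundedInverse (mulOp m) (mulCLM n hn hb) where
  right_inv g := by
    have hae : (fun x => m x * mulCLM n hn hb g x) =ᵐ[volume] g := by
      filter_upwards [mulCLM_ae n hn hb g] with x hx
      rw [hx, ← mul_assoc, hmn, one_mul]
    have hmem : mulCLM n hn hb g ∈ (mulOp m).domain := (memLp_congr_ae hae).2 (Lp.memLp g)
    exact ⟨hmem, Lp.ext ((MemLp.coeFn_toLp hmem).trans hae)⟩
  left_inv f := by
    refine Lp.ext ?_
    filter_upwards [mulCLM_ae n hn hb (mulOp m f), MemLp.coeFn_toLp f.2] with x hn hm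
    exact hn.trans (by rw [show mulOp m f x = m x * (f : L2) x from hm, ← mul_assoc,
      mul_comm (n x), hmn, one_mul])

theorem IsBoundedInverse.unitary_conj {H : Type*} [NormedAddCommGroup H] [InnerProductSpace ℂ H]
    {W W' : H →ₗ.[ℂ] H} {R R' : H →L[ℂ] H} (hR : IsBoundedInverse W R) (F : H ≃ₗᵢ[ℂ] H)
    (hdom : ∀ f, f ∈ W'.domain ↔ F f ∈ W.domain)
    (hW' : ∀ f : W'.domain, W' f = F.symm (W ⟨F f, (hdom f).1 f.2⟩))
    (hR' : ∀ f, R' f = F.symm (R (F f))) : IsBoundedInverse W' R' where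
  right_inv g := by
    obtain ⟨h, hW⟩ := hR.right_inv (F g)
    have hF : F (R' g) = R (F g) := by rw [hR', F.apply_symm_apply]
    refine ⟨(hdom _).2 (hF ▸ h), ?_⟩
    simp only [hW', hF, hW, F.symm_apply_apply]
  left_inv f := by
    rw [hR', hW', F.apply_symm_apply, hR.left_inv, F.symm_apply_apply]

theorem isBoundedInverse_fourierMulOp {m : E3 → ℂ} {R : L2 →L[ℂ] L2}
    (hR : IsBoundedInverse (mulOp m) R) : IsBoundedInverse (fourierMulOp m) (fourierConj R) :=
  hR.unitary_conj fourierL2 (fun _ => Iff.rfl) (fun _ => rfl) (fourierConj_apply R)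

theorem adjoint_fourierConj (A : L2 →L[ℂ] L2) :
    adjoint (fourierConj A) = fourierConj (adjoint A) := by
  refine ((ContinuousLinearMap.eq_adjoint_iff _ _).2 fun f g => ?_).symm
  rw [fourierConj_apply, fourierConj_apply, ← fourierL2.inner_map_map,
    LinearIsometryEquiv.apply_symm_apply, ← fourierL2.inner_map_map f,
    LinearIsometryEquiv.apply_symm_apply, adjoint_inner_left]

theorem adjoint_invWeightCLM (lam : ℝ) {σ : ℝ} (hσ : 0 ≤ σ) :
    adjoint (invWeightCLM lam hσ) = invWeightCLM lam hσ :=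
  adjoint_mulCLM_of_conj_eq _ _ fun _ => Complex.conj_ofReal _

theorem bracket_rpow_mul_invWeight (lam σ : ℝ) (x : E3) :
    ((bracket (lam • x) ^ σ : ℝ) : ℂ) * invWeight lam σ x = 1 := by
  rw [invWeight, ← Complex.ofReal_mul, ← Real.rpow_add (bracket_pos _), add_neg_cancel,
    Real.rpow_zero, Complex.ofReal_one]

theorem isBoundedInverse_positionWeight {σ : ℝ} (hσ : 0 ≤ σ) :
    IsBoundedInverse (positionWeight σ) (invWeightCLM 1 hσ) :=
  isBoundedInverse_mulOp _ _ fun x => by simpa using bracket_rpow_mul_invWeight 1 σ x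

theorem isBoundedInverse_momentumWeight (ħ : ℝ) {σ : ℝ} (hσ : 0 ≤ σ) :
    IsBoundedInverse (momentumWeight ħ σ) (fourierConj (invWeightCLM (2 * Real.pi * ħ) hσ)) :=
  isBoundedInverse_fourierMulOp
    (isBoundedInverse_mulOp _ _ fun x => bracket_rpow_mul_invWeight (2 * Real.pi * ħ) σ x)

theorem evolve_eq_of_isSandwich {W : L2 →ₗ.[ℂ] L2} {R γ B : L2 →L[ℂ] L2} (h : IsSandwich W γ B)
    (hR : IsBoundedInverse W R) (hadj : adjoint R = R) (ħ t : ℝ) :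
    evolve ħ t γ = (freeFlow ħ t ∘L R) ∘L B ∘L adjoint (freeFlow ħ t ∘L R) := by
  rw [evolve, h.eq_comp hR, ContinuousLinearMap.adjoint_comp, hadj]
  simp only [ContinuousLinearMap.comp_assoc]

theorem freeFlow_comp_fourierConj_mulCLM (ħ t : ℝ) {m : E3 → ℂ} (hm : Measurable m)
    (hb : ∀ x, ‖m x‖ ≤ 1) :
    freeFlow ħ t ∘L fourierConj (mulCLM m hm hb) =
      ((fourierL2.symm.toContinuousLinearEquiv : L2 →L[ℂ] L2) ∘L mulCLM m hm hb) ∘L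
        mulCLM (freeSymbol ħ t) (measurable_freeSymbol ħ t) (norm_freeSymbol_le ħ t) ∘L
          (fourierL2.toContinuousLinearEquiv : L2 →L[ℂ] L2) := by
  ext1 f
  have hcomm := DFunLike.congr_fun (mulCLM_comm (measurable_freeSymbol ħ t)
    (norm_freeSymbol_le ħ t) hm hb) (fourierL2 f)
  simp only [ContinuousLinearMap.comp_apply] at hcomm
  simp only [freeFlow, ContinuousLinearMap.comp_apply, fourierConj_apply,
    ContinuousLinearEquiv.coe_coe, LinearIsometryEquiv.coe_toContinuousLinearEquiv,
    LinearIsometryEquiv.apply_symm_apply, hcomm]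

theorem freeFlow_comp_fourierConj_invWeightCLM (ħ t lam : ℝ) {σ : ℝ} (hσ : 0 ≤ σ) :
    freeFlow ħ t ∘L fourierConj (invWeightCLM lam hσ) =
      ((fourierL2.symm.toContinuousLinearEquiv : L2 →L[ℂ] L2) ∘L invWeightCLM lam hσ) ∘L
        mulCLM (freeSymbol ħ t) (measurable_freeSymbol ħ t) (norm_freeSymbol_le ħ t) ∘L
          (fourierL2.toContinuousLinearEquiv : L2 →L[ℂ] L2) :=
  freeFlow_comp_fourierConj_mulCLM ħ t _ _

theorem norm_coe_linearIsometryEquiv_le_one {H : Type*} [NormedAddCommGroup H]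
    [InnerProductSpace ℂ H] (F : H ≃ₗᵢ[ℂ] H) :
    ‖(F.toContinuousLinearEquiv : H →L[ℂ] H)‖ ≤ 1 :=
  F.toLinearIsometry.norm_toContinuousLinearMap_le

theorem norm_comp_le_one {H : Type*} [NormedAddCommGroup H] [InnerProductSpace ℂ H]
    {A B : H →L[ℂ] H} (hA : ‖A‖ ≤ 1) (hB : ‖B‖ ≤ 1) : ‖A ∘L B‖ ≤ 1 :=
  (ContinuousLinearMap.opNorm_comp_le A B).trans (mul_le_one₀ hA (norm_nonneg B) hB)

theorem norm_freeSymbol_comp_fourier_le_one (ħ t : ℝ) :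
    ‖mulCLM (freeSymbol ħ t) (measurable_freeSymbol ħ t) (norm_freeSymbol_le ħ t) ∘L
      (fourierL2.toContinuousLinearEquiv : L2 →L[ℂ] L2)‖ ≤ 1 :=
  norm_comp_le_one (norm_mulCLM_le _ _ zero_le_one (norm_freeSymbol_le ħ t))
    (norm_coe_linearIsometryEquiv_le_one fourierL2)

theorem norm_freeFlow_le_one (ħ t : ℝ) : ‖freeFlow ħ t‖ ≤ 1 :=
  norm_comp_le_one (norm_coe_linearIsometryEquiv_le_one fourierL2.symm)
    (norm_freeSymbol_comp_fourier_le_one ħ t)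

end Sandwich

section UniformBounds

theorem HasDensityBound.mono_const {ħ : ℝ} {A : L2 →L[ℂ] L2} {r N : ℝ≥0∞} {C C' : ℝ}
    (h : HasDensityBound ħ A r C N) (hC : C ≤ C') : HasDensityBound ħ A r C' N :=
  h.congr_right id (by gcongr)

theorem HasDensityBound.scaledSchattenNorm_right {ħ : ℝ} (hħ : 0 < ħ) {A B : L2 →L[ℂ] L2}
    {r : ℝ≥0∞} {C : ℝ} (hC : 0 ≤ C)
    (h : HasDensityBound ħ A r (C * (2 * Real.pi * ħ) ^ (3 * (r⁻¹).toReal)) (schattenNorm r B)) :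
    HasDensityBound ħ A r C (scaledSchattenNorm ħ r B) := by
  have hscale : 0 < ENNReal.ofReal ((2 * Real.pi * ħ) ^ (3 * (r⁻¹).toReal)) :=
    ENNReal.ofReal_pos.2 (by positivity)
  refine h.congr_right (fun hN => ENNReal.lt_top_of_mul_ne_top_right hN.ne hscale.ne') ?_
  rw [scaledSchattenNorm, ENNReal.ofReal_mul hC, mul_assoc]

theorem hasDensityBound_sandwichNorm {ħ C : ℝ} (hC : 0 < C) {W : L2 →ₗ.[ℂ] L2}
    {γ A : L2 →L[ℂ] L2} {r : ℝ≥0∞}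
    (h : ∀ B, IsSandwich W γ B → HasDensityBound ħ A r C (scaledSchattenNorm ħ r B)) :
    HasDensityBound ħ A r C (sandwichNorm ħ r W γ) := by
  refine ⟨fun hfin => ?_, fun ρ hρ => ?_⟩
  · simp only [sandwichNorm, iInf_lt_iff] at hfin
    obtain ⟨B, hB, hfin⟩ := hfin
    exact (h B hB).1 hfin
  · have hC0 := (ENNReal.ofReal_pos.2 hC).ne'
    simp only [sandwichNorm, ENNReal.mul_iInf_of_ne hC0 ENNReal.ofReal_ne_top]
    exact le_iInf₂ fun B hB => (h B hB).2 ρ hρ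

theorem pow_three_mul_inv_rpow {x s : ℝ} (hx : 0 < x) (hs : 0 < s) (α : ℝ) :
    x ^ 3 * (((x * s) ^ 3)⁻¹) ^ α = x ^ (3 * (1 - α)) / s ^ (3 * α) := by
  rw [mul_sub, mul_one, Real.rpow_sub hx, mul_pow, Real.inv_rpow (by positivity),
    Real.mul_rpow (by positivity) (by positivity), Real.rpow_mul hx.le, Real.rpow_mul hs.le]
  norm_cast
  field_simp

theorem hasDensityBound_conj_invWeight {r r' : ℝ≥0∞} [hrr : ENNReal.HolderConjugate r r']
    {ħ s lam κ σ : ℝ} (hħ : 0 < ħ) (hs : 0 < s) (hlam : 0 < lam) (hσ₀ : 0 < σ)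
    (hσ : 3 / 2 * (r'⁻¹).toReal < σ) (hscale : κ ^ 2 / lam ^ 3 = ((2 * Real.pi * ħ * s) ^ 3)⁻¹)
    {V G : L2 →L[ℂ] L2} {k : E3 → E3 → ℂ} (hV : ‖V‖ ≤ 1) (hG : ‖G‖ ≤ 1)
    (hk : IsBoundedKernel V k κ) (B : L2 →L[ℂ] L2) :
    HasDensityBound ħ (((V ∘L invWeightCLM lam hσ₀.le) ∘L G) ∘L B ∘L
        adjoint ((V ∘L invWeightCLM lam hσ₀.le) ∘L G)) r
      (2 * weightConst σ (r'⁻¹).toReal / s ^ (3 * (r'⁻¹).toReal)) (scaledSchattenNorm ħ r B) := by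
  have hc := weightConst_pos hσ
  refine .scaledSchattenNorm_right hħ (by positivity) ?_
  have hbound := hasDensityBound_conj_adjoint hħ hrr.one_le
    (S := (V ∘L invWeightCLM lam hσ₀.le) ∘L G) (B := B)
    (C := weightConst σ (r'⁻¹).toReal * (κ ^ 2 / lam ^ 3) ^ (r'⁻¹).toReal)
    (mul_pos hc (by rw [hscale]; positivity)) fun U hU =>
      eLpNorm_localDensity_invWeight_le hV (norm_comp_le_one hG hU) hk hlam hσ₀ hσ B
  refine hbound.mono_const (le_of_eq ?_)
  rw [hscale, toReal_inv_eq_one_sub r r', div_mul_eq_mul_div, mul_div_assoc,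
    ← pow_three_mul_inv_rpow (by positivity) hs]
  ring

theorem hasDensityBound_one_conj_adjoint {ħ : ℝ} (hħ : 0 < ħ) {S : L2 →L[ℂ] L2} (hS : ‖S‖ ≤ 1)
    (B : L2 →L[ℂ] L2) :
    HasDensityBound ħ (S ∘L B ∘L adjoint S) 1 2 (scaledSchattenNorm ħ 1 B) := by
  refine .scaledSchattenNorm_right hħ two_pos.le ?_
  have hbound := hasDensityBound_conj_adjoint (S := S) (B := B) (N := schattenNorm 1 B)
    hħ le_rfl one_pos fun U hU => by
      rw [← ContinuousLinearMap.comp_assoc]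
      simpa only [one_pow] using eLpNorm_one_localDensity_absRoot_le (norm_comp_le_one hS hU) B
  refine hbound.mono_const (le_of_eq ?_)
  rw [inv_one, ENNReal.toReal_one, mul_one, mul_one, mul_comm]
  norm_cast

variable {ħ σ : ℝ} {r : ℝ≥0∞}

theorem hasDensityBound_evolve_momentumWeight {r' : ℝ≥0∞} [ENNReal.HolderConjugate r r']
    (hħ : 0 < ħ) (hσ₀ : 0 < σ) (hσ : 3 / 2 * (r'⁻¹).toReal < σ) (t : ℝ) (γ : L2 →L[ℂ] L2) :
    HasDensityBound ħ (evolve ħ t γ) r (2 * weightConst σ (r'⁻¹).toReal)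
      (sandwichNorm ħ r (momentumWeight ħ σ) γ) := by
  refine hasDensityBound_sandwichNorm (mul_pos two_pos (weightConst_pos hσ)) fun B hB => ?_
  rw [evolve_eq_of_isSandwich hB (isBoundedInverse_momentumWeight ħ hσ₀.le)
    (by rw [adjoint_fourierConj, adjoint_invWeightCLM]),
    freeFlow_comp_fourierConj_invWeightCLM]
  have hbound := hasDensityBound_conj_invWeight (r := r) (s := 1) (lam := 2 * Real.pi * ħ)
    hħ one_pos (by positivity) hσ₀ hσ (by rw [one_pow, mul_one, one_div])
    (norm_coe_linearIsometryEquiv_le_one fourierL2.symm)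
    (norm_freeSymbol_comp_fourier_le_one ħ t) isBoundedKernel_fourierL2_symm B
  rwa [Real.one_rpow, div_one] at hbound

theorem hasDensityBound_evolve_positionWeight {r' : ℝ≥0∞} [ENNReal.HolderConjugate r r']
    (hħ : 0 < ħ) (hσ₀ : 0 < σ) (hσ : 3 / 2 * (r'⁻¹).toReal < σ) {t : ℝ} (ht : t ≠ 0)
    (γ : L2 →L[ℂ] L2) :
    HasDensityBound ħ (evolve ħ t γ) r
      (2 * weightConst σ (r'⁻¹).toReal / |t| ^ (3 * (r'⁻¹).toReal))
      (sandwichNorm ħ r (positionWeight σ) γ) := by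
  have ht_pos := abs_pos.2 ht
  have hscale : ((2 * Real.pi * ħ * |t|)⁻¹ ^ (3 / 2 : ℝ)) ^ 2 / 1 ^ 3 =
      ((2 * Real.pi * ħ * |t|) ^ 3)⁻¹ := by
    rw [← Real.rpow_mul_natCast (by positivity), one_pow, div_one, ← inv_pow]
    norm_num
  have hc := weightConst_pos hσ
  refine hasDensityBound_sandwichNorm (by positivity) fun B hB => ?_
  rw [evolve_eq_of_isSandwich hB (isBoundedInverse_positionWeight hσ₀.le)
    (adjoint_invWeightCLM 1 hσ₀.le)]
  exact hasDensityBound_conj_invWeight (G := .id ℂ L2) hħ ht_pos one_pos hσ₀ hσ hscale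
    (norm_freeFlow_le_one ħ t) ContinuousLinearMap.norm_id_le (isBoundedKernel_freeFlow hħ ht) B

theorem hasDensityBound_one_evolve_positionWeight (hħ : 0 < ħ) (hσ : 0 ≤ σ) (t : ℝ)
    (γ : L2 →L[ℂ] L2) :
    HasDensityBound ħ (evolve ħ t γ) 1 2 (sandwichNorm ħ 1 (positionWeight σ) γ) := by
  refine hasDensityBound_sandwichNorm two_pos fun B hB => ?_
  rw [evolve_eq_of_isSandwich hB (isBoundedInverse_positionWeight hσ) (adjoint_invWeightCLM 1 hσ)]
  exact hasDensityBound_one_conj_adjoint hħ (norm_comp_le_one (norm_freeFlow_le_one ħ t)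
    (norm_mulCLM_le _ _ zero_le_one (norm_invWeight_le_one 1 hσ))) B

end UniformBounds

end Semiclassical

end

theorem mainTheorem5 (r r' : ℝ≥0∞) (hr : 1 ≤ r) (hrr' : ENNReal.HolderConjugate r r')
    (σ : ℝ) (hσ : 3 / 2 * (r'⁻¹).toReal < σ) :
    ∃ C : ℝ, 0 < C ∧
      ∀ (ħ : ℝ), 0 < ħ → ∀ (t : ℝ) (γ₀ : Semiclassical.L2 →L[ℂ] Semiclassical.L2),
        ((Semiclassical.sandwichNorm ħ r (Semiclassical.momentumWeight ħ σ) γ₀ < ∞ →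
            ∃ ρ, Semiclassical.IsDensity ħ (Semiclassical.evolve ħ t γ₀) ρ) ∧
          ∀ ρ, Semiclassical.IsDensity ħ (Semiclassical.evolve ħ t γ₀) ρ →
            eLpNorm ρ r volume ≤ ENNReal.ofReal C *
              Semiclassical.sandwichNorm ħ r (Semiclassical.momentumWeight ħ σ) γ₀) ∧
        (t ≠ 0 ∨ r = 1 →
          (Semiclassical.sandwichNorm ħ r (Semiclassical.positionWeight σ) γ₀ < ∞ →
            ∃ ρ, Semiclassical.IsDensity ħ (Semiclassical.evolve ħ t γ₀) ρ) ∧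
          ∀ ρ, Semiclassical.IsDensity ħ (Semiclassical.evolve ħ t γ₀) ρ →
            eLpNorm ρ r volume ≤ ENNReal.ofReal (C / |t| ^ (3 * (r'⁻¹).toReal)) *
              Semiclassical.sandwichNorm ħ r (Semiclassical.positionWeight σ) γ₀) := by
  open Semiclassical in
  have hσ₀ : 0 < σ := (by positivity : 0 ≤ 3 / 2 * (r'⁻¹).toReal).trans_lt hσ
  refine ⟨2 * weightConst σ (r'⁻¹).toReal, mul_pos two_pos (weightConst_pos hσ),
    fun ħ hħ t γ₀ => ⟨hasDensityBound_evolve_momentumWeight hħ hσ₀ hσ t γ₀, ?_⟩⟩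
  rintro (ht | rfl)
  · exact hasDensityBound_evolve_positionWeight hħ hσ₀ hσ ht γ₀
  · have hα : (r'⁻¹).toReal = 0 := by
      have h := toReal_inv_eq_one_sub 1 r'
      rw [inv_one, ENNReal.toReal_one] at h
      linarith
    rw [hα, mul_zero, Real.rpow_zero, div_one]
    exact (hasDensityBound_one_evolve_positionWeight hħ hσ₀.le t γ₀).mono_const
      (by linarith [one_le_weightConst_zero hσ₀])
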